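/- **Setting.** For $N\ge 0$, let $\lambda=(\lambda_1\ge\dots\ge\lambda_N\ge0)$ be a partition of $N$ (so $\sum_i\lambda_i=N$). Let $h_n$ be the Hermite polynomials given by $e^{xz-z^2/2}=\sum_{n\ge0}h_n(x)z^n$, put $m_i=N+\lambda_i-i$ $(1\le i\le N)$, and define the exceptional Hermites, which are rational functions of $x$, by $$\hat h_n^\lambda=\frac{\mathrm{Wr}(h_{m_1},\dots,h_{m_N},h_n)}{\mathrm{Wr}(h_{m_1},\dots,h_{m_N})},\qquad n\ge 0 .$$ The Hermite product is $\langle f,g\rangle_H=\int_{-\infty}^{\infty}f(x)g(x)e^{-x^2/2}\,dx$ (no complex conjugation). For the $\hat h^\lambda_n$ it is taken along any locally rectifiable path in $\mathbb C$ from $-\infty$ to $+\infty$ that is asymptotic to the real axis at both ends and avoids the zeros of the denominator $\mathrm{Wr}(h_{m_1},\dots,h_{m_N})$. Let $\psi_0(x,y,z)=e^{xz+yz^2}$, $\kappa_i(x,y)=\partial_z^{m_i}\psi_0(x,y,z)|_{z=0}$, and let $$\psi_\lambda(x,y,z)=\frac{\mathrm{Wr}(\kappa_1,\dots,\kappa_N,\psi_0)}{z^N\,\mathrm{Wr}(\kappa_1,\dots,\kappa_N)}$$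 (Wronskians in $x$). Let $\mathcal{CM}_N$ be the set of $\mathcal X=(X,Z,\vec a,\vec b)$ with $X,Z\in\mathbb C^{N\times N}$, $\vec a,\vec b\in\mathbb C^N$ and $[X,Z]-I=\vec b\,\vec a^{\top}$. For $\mathcal X\in\mathcal{CM}_N$ put $$\psi_{\mathcal X}(x,y,z)=\bigl(1+\vec a^{\top}(xI+2yZ-X)^{-1}(zI-Z)^{-1}\vec b\bigr)e^{xz+yz^2},$$ $$\hat{\hat\psi}_{\mathcal X}(x,y,z)=\det(xI+2yZ-X)\,\det(zI-Z)\,\psi_{\mathcal X}(x,y,z),$$ the latter extended to an entire function of $(x,y,z)$. Let $\mathcal X_\lambda$ denote an element of $\mathcal{CM}_N$ with $\psi_{\mathcal X_\lambda}(x,y,z)=\psi_\lambda(x,y,z)$ wherever the denominators of both sides do not vanish. **Statement.** Such an $\mathcal X_\lambda\in\mathcal{CM}_N$ exists. For every $n\ge0$ the norm $\langle\hat h_n^\lambda,\hat h_n^\lambda\rangle_H$ is well defined: paths as above exist, and the improper integral converges along every such path, with a value independent of the path. For every choice of $\mathcal X_\lambda$ and every $z\in\mathbb C$, the series below converges and $$\sqrt{2\pi}\;\hat{\hat\psi}_{\mathcal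 X_\lambda}(1,0,z)=\sum_{n=0}^{\infty}\langle\hat h_n^\lambda,\hat h_n^\lambda\rangle_H\,z^n .$$ -/

import Mathlib

open Filter Topology
open scoped Matrix

noncomputable section

namespace KPHermite

/-! ## Calogero-Moser matrices and their wave functions -/

/-- `psi0 x y z = exp (x z + y z ^ 2)`, the trivial KP wave function at the times
`t₁ = x`, `t₂ = y`, `tₙ = 0` for `n ≥ 3`. -/
def psi0 (x y z : ℂ) : ℂ := Complex.exp (x * z + y * z ^ 2)

/-- The set of Calogero-Moser matrices: pairs of complex `N × N` matrices and of `N`-vectors with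
the rank one condition `[X, Z] - I = b aᵀ`. -/
structure CalogeroMoser (N : ℕ) where
  X : Matrix (Fin N) (Fin N) ℂ
  Z : Matrix (Fin N) (Fin N) ℂ
  a : Fin N → ℂ
  b : Fin N → ℂ
  rank_one : X * Z - Z * X - 1 = Matrix.vecMulVec b a

namespace CalogeroMoser

variable {N : ℕ} (C : CalogeroMoser N)

/-- The matrix `x I + 2 y Z - X`. -/
def tildeX (x y : ℂ) : Matrix (Fin N) (Fin N) ℂ := x • 1 + (2 * y) • C.Z - C.X

/-- The matrix `z I - Z`. -/
def tildeZ (z : ℂ) : Matrix (Fin N) (Fin N) ℂ := z • 1 - C.Z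

/-- The wave function
`(1 + aᵀ (x I + 2 y Z - X)⁻¹ (z I - Z)⁻¹ b) exp (x z + y z ^ 2)`; it is meaningful where both
matrices are invertible. -/
def psi (x y z : ℂ) : ℂ :=
  (1 + C.a ⬝ᵥ ((C.tildeX x y)⁻¹ *ᵥ ((C.tildeZ z)⁻¹ *ᵥ C.b))) * psi0 x y z

/-- The polynomial `τ(x, y) = det (x I + 2 y Z - X)`. -/
def tau (x y : ℂ) : ℂ := (C.tildeX x y).det

/-- The polynomial `q(z) = det (z I - Z)`. -/
def q (z : ℂ) : ℂ := (C.tildeZ z).det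

/-- The doubly-normalized wave function `τ(x, y) q(z) ψ(x, y, z)`, as an entire function of all
three variables: multiplication by the two determinants turns the inverse matrices into adjugates
(see `psiHatHat_eq`). -/
def psiHatHat (x y z : ℂ) : ℂ :=
  (C.tau x y * C.q z
    + C.a ⬝ᵥ ((C.tildeX x y).adjugate *ᵥ ((C.tildeZ z).adjugate *ᵥ C.b))) * psi0 x y z

theorem psiHatHat_eq {x y z : ℂ} (hx : C.tau x y ≠ 0) (hz : C.q z ≠ 0) :
    C.psiHatHat x y z = C.tau x y * C.q z * C.psi x y z := by
  have hx' : (C.tildeX x y).adjugate = C.tau x y • (C.tildeX x y)⁻¹ := by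
    rw [Matrix.inv_def, smul_smul, Ring.inverse_eq_inv']
    unfold tau at hx ⊢
    rw [mul_inv_cancel₀ hx, one_smul]
  have hz' : (C.tildeZ z).adjugate = C.q z • (C.tildeZ z)⁻¹ := by
    rw [Matrix.inv_def, smul_smul, Ring.inverse_eq_inv']
    unfold q at hz ⊢
    rw [mul_inv_cancel₀ hz, one_smul]
  unfold psiHatHat psi
  rw [hx', hz']
  simp only [Matrix.smul_mulVec, Matrix.mulVec_smul, dotProduct_smul, smul_eq_mul]
  ring

end CalogeroMoser

/-! ## Wronskians, exceptional Hermites and the wave function of a partition -/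

/-- The Wronskian `Wr(f₀, …, f_{k-1})` of functions of one complex variable. -/
def wronskian {k : ℕ} (f : Fin k → ℂ → ℂ) (x : ℂ) : ℂ :=
  (Matrix.of fun i j : Fin k => iteratedDeriv i (f j) x).det

/-- The classical Hermite polynomials `hₙ = Heₙ / n!`, normalized so that
`exp (x z - z ^ 2 / 2) = ∑ hₙ(x) zⁿ`. -/
def h (n : ℕ) (x : ℂ) : ℂ := Polynomial.aeval x (Polynomial.hermite n) / (n.factorial : ℂ)

/-- For parts `lam 0, …, lam (N - 1)` (indexed from `0`), the exponents `N + λ_n - n`,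
`n = 1, …, N`. -/
def expo {N : ℕ} (lam : Fin N → ℕ) (i : Fin N) : ℕ := N + lam i - (i + 1)

/-- `Wr(h_{N+λ₁-1}, …, h_{N+λ_N-N})`. -/
def hermiteWronskian {N : ℕ} (lam : Fin N → ℕ) : ℂ → ℂ :=
  wronskian fun i => h (expo lam i)

/-- The differential operator `K_λ`. -/
def K {N : ℕ} (lam : Fin N → ℕ) (f : ℂ → ℂ) (x : ℂ) : ℂ :=
  wronskian (Fin.snoc (α := fun _ => ℂ → ℂ) (fun i => h (expo lam i)) f) x /
    hermiteWronskian lam x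

/-- The exceptional Hermites `ĥₙ^λ = K_λ(hₙ)`, rational functions of `x`. -/
def hHat {N : ℕ} (lam : Fin N → ℕ) (n : ℕ) : ℂ → ℂ := K lam (h n)

/-- `κ_n(x, y)`, the `z`-derivative of order `N + λ_n - n` of `psi0 x y z` at `z = 0`. -/
def kappa {N : ℕ} (lam : Fin N → ℕ) (y : ℂ) (i : Fin N) (x : ℂ) : ℂ :=
  iteratedDeriv (expo lam i) (psi0 x y) 0

/-- The KP wave function
`ψ_λ(x, y, z) = Wr(κ₁, …, κ_N, ψ₀) / (z ^ N Wr(κ₁, …, κ_N))` (derivatives in `x = t₁`). -/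
def psiLam {N : ℕ} (lam : Fin N → ℕ) (x y z : ℂ) : ℂ :=
  wronskian (Fin.snoc (α := fun _ => ℂ → ℂ) (kappa lam y) (fun s => psi0 s y z)) x /
    (z ^ N * wronskian (kappa lam y) x)

/-- `C` is a choice of the Calogero-Moser matrices `𝒳_λ`, that is, `ψ_C(x, y, z) = ψ_λ(x, y, z)`
wherever the denominators of both sides do not vanish. (The matrices are determined by this
up to simultaneous conjugation.) -/
def IsPartitionPoint {N : ℕ} (lam : Fin N → ℕ) (C : CalogeroMoser N) : Prop :=
  ∀ x y z : ℂ, C.tau x y ≠ 0 → C.q z ≠ 0 → z ≠ 0 → wronskian (kappa lam y) x ≠ 0 →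
    C.psi x y z = psiLam lam x y z

/-! ## The Hermite product -/

/-- A locally rectifiable path in `ℂ` from `-∞` to `+∞` that is asymptotic to the real axis at
both ends and avoids the set `S`. -/
structure IsHermitePath (S : Set ℂ) (γ : ℝ → ℂ) : Prop where
  continuous : Continuous γ
  differentiable : ∃ E : Set ℝ, E.Countable ∧ ∀ t ∉ E, DifferentiableAt ℝ γ t
  integrable : ∀ s t : ℝ, IntervalIntegrable (deriv γ) MeasureTheory.volume s t
  re_atTop : Tendsto (fun t => (γ t).re) atTop atTop
  re_atBot : Tendsto (fun t => (γ t).re) atBot atBot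
  im_atTop : Tendsto (fun t => (γ t).im) atTop (𝓝 0)
  im_atBot : Tendsto (fun t => (γ t).im) atBot (𝓝 0)
  avoids : ∀ t, γ t ∉ S

/-- The Hermite product `⟨f, g⟩_H = ∫_{-∞}^{∞} f(x) g(x) exp (-x ^ 2 / 2) dx` of functions
whose singularities lie in `S` is well defined and equal to `v`: there are paths as above, and
along every one of them the improper integral converges to `v`. -/
def HasHermiteProduct (S : Set ℂ) (f g : ℂ → ℂ) (v : ℂ) : Prop :=
  (∃ γ, IsHermitePath S γ) ∧
  ∀ γ, IsHermitePath S γ →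
    Tendsto
      (fun p : ℝ × ℝ => ∫ t in p.1..p.2,
        f (γ t) * g (γ t) * Complex.exp (-(γ t) ^ 2 / 2) * deriv γ t)
      (atBot ×ˢ atTop) (𝓝 v)

theorem HasHermiteProduct.unique {S : Set ℂ} {f g : ℂ → ℂ} {v w : ℂ}
    (hv : HasHermiteProduct S f g v) (hw : HasHermiteProduct S f g w) : v = w := by
  obtain ⟨γ, hγ⟩ := hv.1
  exact tendsto_nhds_unique (hv.2 γ hγ) (hw.2 γ hγ)

end KPHermite

end

/-! Write `m_i` for `expo lam i`. Both sides equal `√(2π) ∑ ∏ᵢ (n - mᵢ) zⁿ / n!`.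

Norms. `K_λ` is a composition of `N` Darboux transformations. If `f` and `φ` are eigenfunctions of
`∂² - x ∂ + V` with eigenvalues `-n` and `-m`, and `g = f' - (φ'/φ) f`, then `g² = (n - m) f² +
(fg)' - x fg`. Since `(R' - xR) exp(-x²/2)` is the derivative of `R exp(-x²/2)`, each step
multiplies squares by `n - mᵢ` up to an exact term. Together with `hₙ² = 1/n!` modulo exact terms,
this gives `(ĥₙ)² = ∏ (n - mᵢ) / n! + R' - xR` with `R` rational (`dWronskian_darboux`,
`pWronskian_hPoly`). After reduction `R` has poles only at zeros of the denominator of `ĥₙ`, so the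
integrand has a single-valued primitive there. This yields convergence and path independence, and
only the Gaussian integral survives (`hasHermiteProduct_hHat`).

Wave function. At `y = 0` the `κᵢ` are the monomials `x ^ mᵢ`, so both Wronskians reduce to
determinants of falling factorials. As `∑ n(n-1)⋯(n-i+1) zⁿ / n! = zⁱ eᶻ`, the bordered determinant
times `eᶻ` is the generating function of Vandermonde quotients, that is, of `∏ (n - mᵢ) / n!`
(`hasSum_det_borderedMatrix`). The normalizing determinants are the same for every choice of
matrices: the leading term of `ψ` at `z = ∞` and the rank one condition determine `χ'/χ` for the
characteristic polynomial `χ` of `X`, which forces `χ = x^N`, and bispectral duality gives the same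
for `Z` (`CalogeroMoser.charpoly_X_eq`).

Existence. `X` and `Z` act as weighted shifts on chains read off from the Frobenius coordinates `(p
| q)` of the partition, glued in degree `0` by a Cauchy matrix (`HookModule`). Suitable vectors in
this module show that the monic operator of order `N` attached to `ψ_C` annihilates all `κᵢ`, which
identifies it with the Wronskian quotient (`isPartitionPoint_of_isAdapted`). -/

namespace KPHermite

/-! ### Darboux transformations in a differential field. -/

section Darboux

variable {K : Type*} [Field K] [Algebra ℂ K] (D : Derivation ℂ K K)

/-- The Wronskian of elements of a differential field. -/
def dWronskian {k : ℕ} (f : Fin k → K) : K :=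
  (Matrix.of fun i j : Fin k => D^[i] (f j)).det

/-- The first order operator `g ↦ g' - (φ' / φ) g`. -/
def darboux (φ g : K) : K := D g - D φ / φ * g

/-- `D ^ i ∘ darboux D φ` is `D ^ (i + 1)` up to terms of lower order. -/
theorem iterate_darboux (φ : K) (i : ℕ) : ∃ c : ℕ → K, ∀ g,
    D^[i] (darboux D φ g) = D^[i + 1] g + ∑ l ∈ Finset.range (i + 1), c l * D^[l] g := by
  induction i with
  | zero => exact ⟨fun _ => -(D φ / φ), fun g => by simp [darboux]; ring⟩
  | succ i ih =>
    obtain ⟨c, hc⟩ := ih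
    refine ⟨fun l => (if l < i + 1 then D (c l) else 0) + (if 0 < l then c (l - 1) else 0),
      fun g => ?_⟩
    rw [Function.iterate_succ_apply', hc, map_add, ← Function.iterate_succ_apply' D,
      map_sum]
    congr 1
    simp only [add_mul, Finset.sum_add_distrib, Derivation.leibniz, smul_eq_mul]
    rw [add_comm]
    congr 1
    · rw [Finset.sum_range_succ _ (i + 1)]
      simp only [lt_irrefl, if_false, zero_mul, add_zero]
      refine Finset.sum_congr rfl fun l hl => ?_
      rw [if_pos (Finset.mem_range.mp hl)]
      ring
    · rw [Finset.sum_range_succ' _ (i + 1)]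
      simp [Function.iterate_succ_apply']

/-- The coefficients in `iterate_darboux` do not depend on `g`, so one unipotent lower triangular
matrix turns every column into its Darboux transform below the first row. The column of `φ` becomes
`(φ, 0, …, 0)`, because the transformation kills `φ`. -/
theorem dWronskian_cons {k : ℕ} {φ : K} (hφ : φ ≠ 0) (g : Fin k → K) :
    dWronskian D (Fin.cons φ g : Fin (k + 1) → K) = φ * dWronskian D fun j => darboux D φ (g j) := by
  choose c hc using iterate_darboux D φ
  set f : Fin (k + 1) → K := Fin.cons φ g with hf
  set L : Matrix (Fin (k + 1)) (Fin (k + 1)) K := Matrix.of fun i l =>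
    if i = l then 1 else if l < i then c (i - 1) l else 0 with hL
  have hdet : L.det = 1 := by
    rw [Matrix.det_of_isLowerTriangular]
    · simp [hL]
    · intro i l hil
      have hil' : i < l := hil
      simp [hL, hil'.ne, not_lt.mpr hil'.le]
  have hrow (i : Fin (k + 1)) (j : Fin (k + 1)) :
      (L * Matrix.of fun i j : Fin (k + 1) => D^[i] (f j)) i j
        = Fin.cases (f j) (fun i' => D^[i'] (darboux D φ (f j))) i := by
    rw [Matrix.mul_apply]
    simp only [hL, Matrix.of_apply]
    refine Fin.cases ?_ (fun i' => ?_) i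
    · rw [Finset.sum_eq_single 0]
      · simp
      · intro b _ hb
        simp [hb.symm]
      · simp
    · simp only [Fin.cases_succ, hc]
      have h1 : ∀ l : Fin (k + 1), (if i'.succ = l then (1 : K) else
          if l < i'.succ then c ((i'.succ : ℕ) - 1) l else 0) * D^[l] (f j)
          = (if i'.succ = l then D^[l] (f j) else 0)
            + (if (l : ℕ) < i' + 1 then c i' l * D^[l] (f j) else 0) := by
        intro l
        by_cases h : i'.succ = l
        · subst h; simp
        · have : (l < i'.succ) ↔ (l : ℕ) < i' + 1 := by rw [Fin.lt_def, Fin.val_succ]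
          by_cases h2 : (l : ℕ) < i' + 1 <;> simp [h, this, h2]
      simp only [h1, Finset.sum_add_distrib]
      congr 1
      · simp
      · rw [Fin.sum_univ_eq_sum_range (fun l => if l < (i' : ℕ) + 1 then c i' l * D^[l] (f j) else 0)
          (k + 1), ← Finset.sum_filter]
        refine Finset.sum_congr ?_ fun _ _ => rfl
        ext l
        simp only [Finset.mem_filter, Finset.mem_range]
        have := i'.2
        omega
  have key : dWronskian D f = (L * Matrix.of fun i j : Fin (k + 1) => D^[i] (f j)).det := by
    rw [Matrix.det_mul, hdet, one_mul, dWronskian]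
  rw [key, Matrix.det_succ_column_zero, Fin.sum_univ_succ]
  have hz : ∀ i : Fin k, (L * Matrix.of fun i j : Fin (k + 1) => D^[i] (f j)) i.succ 0 = 0 := by
    intro i
    rw [hrow]
    have : darboux D φ φ = 0 := by simp [darboux, hφ]
    simp [hf, this, iterate_map_zero]
  simp only [hz, hrow 0 0]
  simp only [Fin.val_zero, pow_zero, one_mul, mul_zero, zero_mul, Finset.sum_const_zero, add_zero,
    Fin.cases_zero]
  rw [show f 0 = φ from rfl, dWronskian]
  congr 2
  ext i j
  rw [Matrix.submatrix_apply, Fin.succAbove_zero, hrow]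
  simp [hf]

/-- A Darboux transformation maps solutions of `f'' - x f' + V f = -n f` to solutions of an equation
of the same form. -/
theorem darboux_step {x V φ f m n : K} (hx : D x = 1) (hn : D n = 0) (hm : D m = 0) (hφ0 : φ ≠ 0)
    (hφ : D (D φ) - x * D φ + V * φ = -m * φ) (hf : D (D f) - x * D f + V * f = -n * f) :
    D (darboux D φ f) = x * darboux D φ f - (n - m) * f - D φ / φ * darboux D φ f ∧
    D (D (darboux D φ f)) - x * D (darboux D φ f)
        + (-1 - m + D (D φ / φ) + D φ / φ * x - (D φ / φ) ^ 2) * darboux D φ f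
      = -n * darboux D φ f := by
  set u := D φ / φ with hu
  -- The Riccati equation of the logarithmic derivative; it eliminates `V`.
  have hu' : D u = x * u - V - m - u ^ 2 := by
    have h1 : D φ = u * φ := by rw [hu]; field_simp
    have h2 : D (D φ) = u * D φ + φ * D u := by
      conv_lhs => rw [h1]
      simp [smul_eq_mul]
    have h3 : φ * D u = φ * (x * u - V - m - u ^ 2) := by
      rw [h2, h1] at hφ
      linear_combination hφ
    exact mul_left_cancel₀ hφ0 h3
  set g := darboux D φ f with hg
  have hgf : g = D f - u * f := rfl
  have hg1 : D g = x * g - (n - m) * f - u * g := by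
    rw [hgf, map_sub, Derivation.leibniz, hu']
    simp only [smul_eq_mul]
    linear_combination hf
  refine ⟨hg1, ?_⟩
  have hf1 : D f = g + u * f := by rw [hgf]; ring
  have hg2 : D (D g) = g + x * D g - (n - m) * D f - u * D g - g * D u := by
    rw [hg1]
    simp only [map_sub, Derivation.leibniz, smul_eq_mul, hx, hn, hm]
    rw [hg1]
    ring
  rw [hg2, hg1, hf1]
  ring

/-- Iterated Darboux transformations preserve squares up to the factor `∏ (n - mᵢ)` and an exact
term for the weight `exp (-x ^ 2 / 2)`. -/
theorem dWronskian_darboux {x : K} (hx : D x = 1) [CharZero K] : ∀ {N : ℕ} (V : K) (φ : Fin N → K)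
    (m : Fin N → ℕ), Function.Injective m → (∀ i, φ i ≠ 0) →
    (∀ i, D (D (φ i)) - x * D (φ i) + V * φ i = -(m i : K) * φ i) →
    dWronskian D φ ≠ 0 ∧ ∀ (f : K) (n : ℕ), D (D f) - x * D f + V * f = -(n : K) * f →
    ∃ R : K, (dWronskian D (Fin.snoc φ f : Fin (N + 1) → K) / dWronskian D φ) ^ 2
      = (∏ i, ((n : K) - m i)) * f ^ 2 + (D R - x * R) := by
  intro N
  induction N with
  | zero =>
    intro V φ m _ _ _
    refine ⟨by simp [dWronskian], fun f n _ => ⟨0, ?_⟩⟩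
    simp [dWronskian, Fin.snoc]
  | succ N ih =>
    intro V φ m hm hφ0 hφ
    have hD : ∀ k : ℕ, D (k : K) = 0 := fun k => D.map_natCast k
    have hφ' := Fin.cons_self_tail φ
    set ψ : Fin N → K := fun j => darboux D (φ 0) (φ j.succ) with hψ
    have hstep := fun (f : K) (n : ℕ) hf =>
      darboux_step D (f := f) hx (hD n) (hD (m 0)) (hφ0 0) (hφ 0) hf
    -- If a transform vanished, the first relation of `darboux_step` would give `(n - m) f = 0`,
    -- against the distinctness of the eigenvalues.
    have hψ0 : ∀ j, ψ j ≠ 0 := by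
      intro j hj
      have h1 := (hstep _ _ (hφ j.succ)).1
      rw [show darboux D (φ 0) (φ j.succ) = 0 from hj] at h1
      simp only [map_zero, mul_zero, sub_zero, zero_sub] at h1
      rcases mul_eq_zero.mp (neg_eq_zero.mp h1.symm) with h2 | h2
      · rw [sub_eq_zero, Nat.cast_inj] at h2
        exact Fin.succ_ne_zero _ (hm h2)
      · exact hφ0 _ h2
    obtain ⟨hW, hR⟩ := ih _ ψ (fun j => m j.succ) (fun a b hab => Fin.succ_injective _ (hm hab)) hψ0
      (fun j => (hstep _ _ (hφ j.succ)).2)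
    have hWφ : dWronskian D φ = φ 0 * dWronskian D ψ := by
      conv_lhs => rw [← hφ', dWronskian_cons D (hφ0 0)]
      rfl
    refine ⟨by rw [hWφ]; exact mul_ne_zero (hφ0 0) hW, fun f n hf => ?_⟩
    obtain ⟨R, hR⟩ := hR _ n (hstep f n hf).2
    have hWf : dWronskian D (Fin.snoc φ f : Fin (N + 1 + 1) → K)
        = φ 0 * dWronskian D (Fin.snoc ψ (darboux D (φ 0) f) : Fin (N + 1) → K) := by
      conv_lhs => rw [← hφ', ← Fin.cons_snoc_eq_snoc_cons,
        dWronskian_cons D (hφ0 0)]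
      congr 2
      funext j
      refine Fin.lastCases ?_ (fun i => ?_) j
      · simp
      · simp [hψ, Fin.tail]
    -- With `g = darboux D (φ 0) f`, the first relation of `darboux_step` gives `g² = (n - m₀) f² +
    -- (gf)' - x gf`. The remaining product is a constant and passes through `D`.
    refine ⟨R + (∏ i : Fin N, ((n : K) - m i.succ)) * (darboux D (φ 0) f * f), ?_⟩
    rw [hWf, hWφ, mul_div_mul_left _ _ (hφ0 0), hR, Fin.prod_univ_succ]
    have hDp : D (∏ i : Fin N, ((n : K) - m i.succ)) = 0 := by
      have : (∏ i : Fin N, ((n : K) - m i.succ)) = ((∏ i : Fin N, ((n : ℤ) - m i.succ) : ℤ) : K) := by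
        push_cast; rfl
      rw [this, D.map_intCast]
    rw [map_add, D.leibniz, D.leibniz, hDp, (hstep f n hf).1]
    have hf1 : D f = darboux D (φ 0) f + D (φ 0) / φ 0 * f := by rw [darboux]; ring
    simp only [smul_eq_mul]
    rw [hf1]
    ring

end Darboux

end KPHermite

/-! ### Rational functions and squares of exceptional Hermites modulo exact terms. -/

namespace KPHermite

open Polynomial

/-- The derivation of the field of rational functions that extends the derivative of polynomials. -/
theorem exists_derivation_fractionField (K : Type*) [Field K] [Algebra ℂ K] [Algebra ℂ[X] K]
    [IsScalarTower ℂ ℂ[X] K] [IsFractionRing ℂ[X] K] :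
    ∃ D : Derivation ℂ K K, ∀ p : ℂ[X], D (algebraMap _ _ p) = algebraMap _ _ (derivative p) := by
  -- A derivation is a ring homomorphism `p ↦ p + p' ε` into dual numbers. It extends to fractions
  -- because an element of the dual numbers is a unit as soon as its first component is.
  let g : ℂ[X] →+* TrivSqZeroExt K K :=
    { toFun := fun p => TrivSqZeroExt.inl (algebraMap ℂ[X] K p)
        + TrivSqZeroExt.inr (algebraMap ℂ[X] K (derivative p))
      map_one' := by ext <;> simp
      map_zero' := by ext <;> simp
      map_mul' := fun p q => by
        ext <;> simp only [TrivSqZeroExt.snd_add, TrivSqZeroExt.fst_add, TrivSqZeroExt.snd_inl,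
        TrivSqZeroExt.snd_inr, TrivSqZeroExt.fst_inl, TrivSqZeroExt.fst_inr, TrivSqZeroExt.snd_mul,
        TrivSqZeroExt.fst_mul, map_mul, map_add, derivative_mul, smul_eq_mul,
        MulOpposite.smul_eq_mul_unop, MulOpposite.unop_op, zero_add, add_zero]
        ring
      map_add' := fun p q => by
        ext <;> simp only [TrivSqZeroExt.snd_add, TrivSqZeroExt.fst_add, TrivSqZeroExt.snd_inl,
          TrivSqZeroExt.snd_inr, TrivSqZeroExt.fst_inl, TrivSqZeroExt.fst_inr, map_add, zero_add,
          add_zero] }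
  have hg : ∀ y : nonZeroDivisors ℂ[X], IsUnit (g y) := by
    intro y
    rw [TrivSqZeroExt.isUnit_iff_isUnit_fst]
    simp only [g, RingHom.coe_mk, MonoidHom.coe_mk, OneHom.coe_mk, TrivSqZeroExt.fst_add,
      TrivSqZeroExt.fst_inl, TrivSqZeroExt.fst_inr, add_zero]
    exact IsLocalization.map_units K y
  let φ : K →+* TrivSqZeroExt K K := IsLocalization.lift hg
  have hφ : ∀ p : ℂ[X], φ (algebraMap ℂ[X] K p) = g p := fun p => IsLocalization.lift_eq hg p
  have hfst : ∀ k, (φ k).fst = k := by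
    have : (TrivSqZeroExt.fstHom K K K : TrivSqZeroExt K K →+* K).comp φ = RingHom.id K := by
      apply IsLocalization.ringHom_ext (nonZeroDivisors ℂ[X])
      refine RingHom.ext fun p => ?_
      rw [RingHom.comp_apply, RingHom.comp_apply, hφ]
      simp [g]
    intro k
    exact congrArg (fun f : K →+* K => f k) this
  refine ⟨Derivation.mk' { toFun := fun k => (φ k).snd, map_add' := ?_, map_smul' := ?_ } ?_, ?_⟩
  · intro a b; simp
  · intro c a
    have h1 : (c • a : K) = algebraMap ℂ[X] K (C c) * a := by
      rw [Algebra.smul_def, IsScalarTower.algebraMap_apply ℂ ℂ[X] K]; rfl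
    have h2 : (φ (algebraMap ℂ[X] K (C c))).snd = 0 := by rw [hφ]; simp [g]
    rw [h1, map_mul, TrivSqZeroExt.snd_mul, h2, hfst, hfst]
    simp [Algebra.smul_def, IsScalarTower.algebraMap_apply ℂ ℂ[X] K]
  · intro a b
    simp [TrivSqZeroExt.snd_mul, hfst]
    ring
  · intro p
    change (φ (algebraMap ℂ[X] K p)).snd = _
    rw [hφ]
    change (TrivSqZeroExt.inl (algebraMap ℂ[X] K p)
        + TrivSqZeroExt.inr (algebraMap ℂ[X] K (derivative p))).snd = _
    rw [TrivSqZeroExt.snd_add, TrivSqZeroExt.snd_inl, TrivSqZeroExt.snd_inr, zero_add]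

/-- The Wronskian of polynomials. -/
noncomputable def pWronskian {k : ℕ} (f : Fin k → ℂ[X]) : ℂ[X] :=
  (Matrix.of fun i j : Fin k => derivative^[i] (f j)).det

theorem iteratedDeriv_eval (p : ℂ[X]) (n : ℕ) :
    iteratedDeriv n (fun x => p.eval x) = fun x => (derivative^[n] p).eval x := by
  induction n with
  | zero => simp
  | succ n ih =>
    rw [iteratedDeriv_succ, ih, Function.iterate_succ_apply']
    funext x
    exact Polynomial.deriv _

theorem eval_pWronskian {k : ℕ} (f : Fin k → ℂ[X]) (x : ℂ) :
    (pWronskian f).eval x = wronskian (fun i y => (f i).eval y) x := by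
  rw [pWronskian, wronskian, ← coe_evalRingHom, RingHom.map_det]
  congr 1
  ext i j
  simp [iteratedDeriv_eval]

theorem algebraMap_pWronskian {D : Derivation ℂ (FractionRing ℂ[X]) (FractionRing ℂ[X])}
    (hD : ∀ p : ℂ[X], D (algebraMap _ _ p) = algebraMap _ _ (derivative p))
    {k : ℕ} (f : Fin k → ℂ[X]) :
    algebraMap _ (FractionRing ℂ[X]) (pWronskian f)
      = dWronskian D fun i => algebraMap _ _ (f i) := by
  have hit : ∀ (n : ℕ) (p : ℂ[X]), D^[n] (algebraMap _ _ p)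
      = algebraMap _ _ (derivative^[n] p) := by
    intro n p
    induction n with
    | zero => rfl
    | succ n ih => rw [Function.iterate_succ_apply', ih, hD, Function.iterate_succ_apply']
  rw [pWronskian, dWronskian, RingHom.map_det]
  congr 1
  ext i j
  simp [hit]

/-- The normalized Hermite polynomials `Heₙ / n!` with complex coefficients. -/
noncomputable def hPoly (n : ℕ) : ℂ[X] :=
  C ((n.factorial : ℂ)⁻¹) * (hermite n).map (Int.castRingHom ℂ)

theorem h_eq_eval (n : ℕ) : h n = fun x => (hPoly n).eval x := by
  funext x
  simp only [h, hPoly, eval_mul, eval_C, aeval_def, eval_map]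
  rw [div_eq_inv_mul]
  rfl

theorem derivative_hermite_succ (n : ℕ) :
    derivative (hermite (n + 1)) = ((n : ℤ[X]) + 1) * hermite n := by
  induction n with
  | zero => simp
  | succ n ih =>
    rw [hermite_succ (n + 1), map_sub, derivative_mul, ih, derivative_mul]
    rw [hermite_succ n] at ih ⊢
    simp
    ring

theorem derivative_hPoly_succ (n : ℕ) : derivative (hPoly (n + 1)) = hPoly n := by
  have h1 : (C (((n + 1).factorial : ℂ)⁻¹)) * ((n : ℂ[X]) + 1) = C ((n.factorial : ℂ)⁻¹) := by
    rw [show ((n : ℂ[X]) + 1) = C ((n : ℂ) + 1) by simp, ← C_mul, Nat.factorial_succ]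
    congr 1
    have : (n : ℂ) + 1 ≠ 0 := by exact_mod_cast Nat.succ_ne_zero n
    push_cast
    field_simp
  rw [hPoly, hPoly, derivative_C_mul, derivative_map, derivative_hermite_succ, ← h1]
  simp
  ring

theorem X_mul_hPoly_sub (n : ℕ) :
    X * hPoly n - derivative (hPoly n) = ((n : ℂ[X]) + 1) * hPoly (n + 1) := by
  have h1 : ((n : ℂ[X]) + 1) * C (((n + 1).factorial : ℂ)⁻¹) = C ((n.factorial : ℂ)⁻¹) := by
    rw [show ((n : ℂ[X]) + 1) = C ((n : ℂ) + 1) by simp, ← C_mul, Nat.factorial_succ]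
    congr 1
    have : (n : ℂ) + 1 ≠ 0 := by exact_mod_cast Nat.succ_ne_zero n
    push_cast
    field_simp
  rw [hPoly, hPoly, ← mul_assoc ((n : ℂ[X]) + 1), h1, hermite_succ, derivative_C_mul,
    derivative_map]
  simp
  ring

theorem hPoly_zero : hPoly 0 = 1 := by simp [hPoly]

theorem hPoly_ne_zero (n : ℕ) : hPoly n ≠ 0 := by
  refine mul_ne_zero ?_ ?_
  · simpa using Nat.factorial_ne_zero n
  · rw [Polynomial.map_ne_zero_iff (RingHom.injective_int _)]
    exact (hermite_monic n).ne_zero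

theorem hPoly_ode (n : ℕ) :
    derivative (derivative (hPoly n)) - X * derivative (hPoly n) = -(n : ℂ[X]) * hPoly n := by
  cases n with
  | zero => simp [hPoly_zero]
  | succ n =>
    rw [derivative_hPoly_succ]
    have := X_mul_hPoly_sub n
    push_cast
    linear_combination -this

theorem hPoly_sq {K : Type*} [Field K] [Algebra ℂ K] [Algebra ℂ[X] K] (D : Derivation ℂ K K)
    [IsScalarTower ℂ ℂ[X] K]
    (hD : ∀ p : ℂ[X], D (algebraMap _ _ p) = algebraMap _ _ (derivative p)) (n : ℕ) :
    ∃ R : K, algebraMap ℂ[X] K (hPoly n) ^ 2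
      = algebraMap ℂ K (n.factorial : ℂ)⁻¹ + (D R - algebraMap ℂ[X] K X * R) := by
  induction n with
  | zero => exact ⟨0, by simp [hPoly_zero]⟩
  | succ n ih =>
    obtain ⟨R, hR⟩ := ih
    set c : K := algebraMap ℂ K ((n : ℂ) + 1)⁻¹ with hc
    have hn : (n : ℂ) + 1 ≠ 0 := by exact_mod_cast Nat.succ_ne_zero n
    have hc1 : c * ((n : K) + 1) = 1 := by
      rw [hc, show ((n : K) + 1) = algebraMap ℂ K ((n : ℂ) + 1) by simp, ← map_mul,
        inv_mul_cancel₀ hn, map_one]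
    set a := algebraMap ℂ[X] K (hPoly n) with ha
    set b := algebraMap ℂ[X] K (hPoly (n + 1)) with hb
    have hDb : D b = a := by rw [hb, hD, derivative_hPoly_succ]
    have hDa : D a = algebraMap ℂ[X] K X * a - ((n : K) + 1) * b := by
      rw [ha, hD, hb]
      have := congrArg (algebraMap ℂ[X] K) (X_mul_hPoly_sub n)
      simp only [map_sub, map_mul, map_add, map_natCast, map_one] at this
      linear_combination -this
    -- From `(h_{n+1} h_n)' = h_n² + x h_{n+1} h_n - (n + 1) h_{n+1}²`.
    refine ⟨c * (R - b * a), ?_⟩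
    have hDc : D c = 0 := D.map_algebraMap _
    have hf : algebraMap ℂ K ((n + 1).factorial : ℂ)⁻¹ = c * algebraMap ℂ K (n.factorial : ℂ)⁻¹ := by
      rw [hc, ← map_mul, Nat.factorial_succ]
      push_cast
      rw [mul_inv]
    rw [hf, D.leibniz, hDc, map_sub, D.leibniz, hDa, hDb]
    simp only [smul_eq_mul, mul_zero, add_zero]
    linear_combination c * hR + (-b ^ 2) * hc1

/-- A rational function `A / B` such that `(A / B)' - x A / B` has no pole outside the zeros of `W`
has itself no pole there. -/
theorem eval_ne_zero_of_isCoprime {A B W T : ℂ[X]} (hAB : IsCoprime A B) (hB : B ≠ 0)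
    (h : W ^ 2 * (derivative A * B - A * derivative B - X * A * B) = T * B ^ 2) {x : ℂ}
    (hx : W.eval x ≠ 0) : B.eval x ≠ 0 := by
  intro hBx
  obtain ⟨k, E, hE, hBE⟩ : ∃ k, ∃ E : ℂ[X], E.eval x ≠ 0 ∧ B = (X - C x) ^ k * E := by
    refine ⟨B.rootMultiplicity x, B /ₘ (X - C x) ^ B.rootMultiplicity x, ?_, ?_⟩
    · exact eval_divByMonic_pow_rootMultiplicity_ne_zero x hB
    · exact (pow_mul_divByMonic_rootMultiplicity_eq B x).symm
  have hA : A.eval x ≠ 0 := by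
    intro hA
    obtain ⟨u, v, huv⟩ := hAB
    have := congrArg (eval x) huv
    simp [hA, hBx] at this
  cases k with
  | zero => exact hE (by simpa [hBE] using hBx)
  | succ k =>
    have hd : derivative B = (X - C x) ^ k * (((k : ℂ[X]) + 1) * E + (X - C x) * derivative E) := by
      rw [hBE, derivative_mul, derivative_X_sub_C_pow]
      simp
      ring
    have hne : (X - C x : ℂ[X]) ^ k ≠ 0 := pow_ne_zero _ (X_sub_C_ne_zero x)
    -- At a pole of order `k + 1` of `A / B` the derivative has order `k + 2`. Once `(X - x)^k` is
    -- removed, the left side takes the value `-(k + 1) W² A E` at `x`, while the right side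
    -- vanishes.
    have h2 : W ^ 2 * (derivative A * ((X - C x) * E)
        - A * (((k : ℂ[X]) + 1) * E + (X - C x) * derivative E) - X * A * ((X - C x) * E))
        = T * ((X - C x) ^ (k + 2) * E ^ 2) := by
      apply mul_left_cancel₀ hne
      rw [hd, hBE] at h
      linear_combination h
    have h3 := congrArg (eval x) h2
    simp at h3
    have : (k : ℂ) + 1 ≠ 0 := by exact_mod_cast Nat.succ_ne_zero k
    tauto

/-- The identity `(Wₙ / W)² = c + (A/B)' - x A/B`, cleared of denominators. Intermediate Darboux
steps may introduce poles outside the zeros of `W`; for a reduced fraction `A / B` the identity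
itself excludes them. -/
theorem pWronskian_hPoly {N : ℕ} {m : Fin N → ℕ} (hm : Function.Injective m) :
    pWronskian (fun i => hPoly (m i)) ≠ 0 ∧ ∀ n : ℕ, ∃ A B : ℂ[X], B ≠ 0 ∧
      (∀ x, (pWronskian fun i => hPoly (m i)).eval x ≠ 0 → B.eval x ≠ 0) ∧
      pWronskian (Fin.snoc (fun i => hPoly (m i)) (hPoly n) : Fin (N + 1) → ℂ[X]) ^ 2 * B ^ 2
        = pWronskian (fun i => hPoly (m i)) ^ 2 *
          (C ((∏ i, ((n : ℂ) - m i)) * (n.factorial : ℂ)⁻¹) * B ^ 2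
            + (derivative A * B - A * derivative B - X * A * B)) := by
  obtain ⟨D, hD⟩ := exists_derivation_fractionField (FractionRing ℂ[X])
  have hinj : Function.Injective (algebraMap ℂ[X] (FractionRing ℂ[X])) :=
    IsFractionRing.injective _ _
  have hODE : ∀ n : ℕ, D (D (algebraMap _ (FractionRing ℂ[X]) (hPoly n)))
      - algebraMap ℂ[X] (FractionRing ℂ[X]) X * D (algebraMap _ _ (hPoly n))
      + 0 * (algebraMap _ _ (hPoly n))
      = -(n : FractionRing ℂ[X]) * algebraMap _ _ (hPoly n) := by
    intro n
    have := congrArg (algebraMap ℂ[X] (FractionRing ℂ[X])) (hPoly_ode n)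
    simp only [map_sub, map_mul, map_neg, map_natCast] at this
    rw [hD, hD, zero_mul, add_zero, this]
  obtain ⟨hW, hR⟩ := dWronskian_darboux D (x := algebraMap ℂ[X] _ X) (by rw [hD]; simp) 0
    (fun i => algebraMap _ (FractionRing ℂ[X]) (hPoly (m i))) m hm
    (fun i => (map_ne_zero_iff _ hinj).mpr (hPoly_ne_zero _)) (fun i => hODE _)
  rw [← algebraMap_pWronskian hD] at hW
  have hW0 : pWronskian (fun i => hPoly (m i)) ≠ 0 := fun h => hW (by rw [h, map_zero])
  refine ⟨hW0, fun n => ?_⟩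
  obtain ⟨R1, hR1⟩ := hR _ n (hODE n)
  obtain ⟨R2, hR2⟩ := hPoly_sq D hD n
  set c : ℂ := ∏ i, ((n : ℂ) - m i) with hc
  have hc' : (∏ i, ((n : FractionRing ℂ[X]) - m i)) = algebraMap ℂ _ c := by
    rw [hc, map_prod]; simp
  obtain ⟨A, B, hAB, hR⟩ : ∃ A B : ℂ[X], (IsCoprime A B ∧ B ≠ 0) ∧
      algebraMap ℂ _ c * R2 + R1 = algebraMap _ (FractionRing ℂ[X]) A / algebraMap _ _ B := by
    obtain ⟨A, B, hAB, h⟩ := IsFractionRing.exists_reduced_fraction (A := ℂ[X])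
      (algebraMap ℂ _ c * R2 + R1)
    refine ⟨A, B, ⟨hAB.isCoprime, nonZeroDivisors.coe_ne_zero B⟩, ?_⟩
    rw [← h, IsFractionRing.mk'_eq_div]
  have hB : algebraMap _ (FractionRing ℂ[X]) B ≠ 0 := by
    simpa [map_eq_zero_iff _ hinj] using hAB.2
  have hsn : (Fin.snoc (fun i => algebraMap _ (FractionRing ℂ[X]) (hPoly (m i)))
      (algebraMap _ _ (hPoly n)) : Fin (N + 1) → FractionRing ℂ[X])
      = fun j => algebraMap _ _ ((Fin.snoc (fun i => hPoly (m i)) (hPoly n)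
        : Fin (N + 1) → ℂ[X]) j) := by
    funext j
    refine Fin.lastCases ?_ (fun i => ?_) j <;> simp
  rw [hsn, ← algebraMap_pWronskian hD, ← algebraMap_pWronskian hD, hR2, hc'] at hR1
  set W := pWronskian (fun i => hPoly (m i))
  set Wn := pWronskian (Fin.snoc (fun i => hPoly (m i)) (hPoly n) : Fin (N + 1) → ℂ[X])
  have hDR : D (algebraMap ℂ _ c * R2 + R1) = algebraMap ℂ _ c * D R2 + D R1 := by
    rw [map_add, D.leibniz, D.map_algebraMap]
    simp
  have hDq : D (algebraMap _ (FractionRing ℂ[X]) A / algebraMap _ _ B)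
      = algebraMap _ _ (derivative A * B - A * derivative B) / algebraMap _ _ (B ^ 2) := by
    rw [Derivation.leibniz_div, hD, hD]
    simp only [smul_eq_mul, map_sub, map_mul, map_pow]
    field_simp
  have hfin : Wn ^ 2 * B ^ 2 = W ^ 2 * (C (c * (n.factorial : ℂ)⁻¹) * B ^ 2
      + (derivative A * B - A * derivative B - X * A * B)) := by
    apply hinj
    rw [hR, hDq] at hDR
    have hC : algebraMap ℂ[X] (FractionRing ℂ[X]) (C (c * (n.factorial : ℂ)⁻¹))
        = algebraMap ℂ _ c * algebraMap ℂ _ (n.factorial : ℂ)⁻¹ := by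
      rw [← map_mul]; rfl
    have e1 : (algebraMap _ (FractionRing ℂ[X]) Wn / algebraMap _ _ W) ^ 2
        = algebraMap ℂ _ c * algebraMap ℂ _ (n.factorial : ℂ)⁻¹
        + (algebraMap _ _ (derivative A * B - A * derivative B) / algebraMap _ _ (B ^ 2)
          - algebraMap ℂ[X] _ X * (algebraMap _ (FractionRing ℂ[X]) A / algebraMap _ _ B)) := by
      rw [hR1, hDR, ← hR]
      ring
    generalize (n.factorial : ℂ)⁻¹ = d at e1 hC ⊢
    generalize C (c * d) = Q at hC ⊢
    simp only [map_mul, map_pow, map_add, map_sub, hC] at e1 ⊢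
    field_simp at e1
    linear_combination e1
  refine ⟨A, B, hAB.2, fun x hx => ?_, hfin⟩
  refine eval_ne_zero_of_isCoprime (T := Wn ^ 2 - W ^ 2 * C (c * (n.factorial : ℂ)⁻¹))
    hAB.1 hAB.2 ?_ hx
  linear_combination -hfin

end KPHermite

/-! ### Contour integrals against the Gaussian weight. -/

namespace KPHermite

open Polynomial MeasureTheory

theorem integral_comp_mul_deriv_of_isHermitePath {S : Set ℂ} {γ : ℝ → ℂ} (hγ : IsHermitePath S γ)
    {F f : ℂ → ℂ} (hF : ∀ w ∉ S, HasDerivAt F (f w) w) (hf : ContinuousOn f Sᶜ) (s t : ℝ) :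
    ∫ r in s..t, f (γ r) * deriv γ r = F (γ t) - F (γ s) := by
  obtain ⟨E, hE, hd⟩ := hγ.differentiable
  have hmem : ∀ r, γ r ∈ Sᶜ := hγ.avoids
  have hFc : ContinuousOn F Sᶜ := fun w hw => (hF w hw).continuousAt.continuousWithinAt
  refine integral_eq_of_hasDerivAt_off_countable (fun r => F (γ r)) _ hE
    (hFc.comp_continuous hγ.continuous hmem).continuousOn (fun r hr => ?_) ?_
  · exact HasDerivAt.comp_of_eq r (hF _ (hmem r)) (hd r hr.2).hasDerivAt rfl
  · exact (hγ.integrable s t).continuousOn_mul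
      (hf.comp_continuous hγ.continuous hmem).continuousOn

/-- The curves `t + i c / (1 + t²)` for different `c` are disjoint, so a point of `S` excludes only
the value `c = Im w (1 + (Re w)²)`. -/
theorem exists_isHermitePath {S : Set ℂ} (hS : S.Finite) : ∃ γ, IsHermitePath S γ := by
  obtain ⟨c, hc⟩ := (hS.image fun w => w.im * (1 + w.re ^ 2)).exists_notMem
  have hpos : ∀ t : ℝ, (1 + t ^ 2 : ℝ) ≠ 0 := fun t => by positivity
  obtain ⟨g, hg⟩ : ∃ g : ℝ → ℝ, g = fun t => c / (1 + t ^ 2) := ⟨_, rfl⟩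
  have hdiff : ContDiff ℝ 1 g := by
    rw [hg]
    exact
      contDiff_const.div (by fun_prop) hpos
  have hγ : ContDiff ℝ 1 fun t : ℝ => (t : ℂ) + g t * Complex.I :=
    Complex.ofRealCLM.contDiff.add ((Complex.ofRealCLM.contDiff.comp hdiff).mul contDiff_const)
  have hsq : Tendsto (fun t : ℝ => 1 + t ^ 2) (atBot ⊔ atTop) atTop := by
    refine tendsto_atTop_add_const_left _ _ ?_
    rw [tendsto_sup]
    exact ⟨(tendsto_pow_atTop two_ne_zero).comp tendsto_abs_atBot_atTop |>.congr fun t => by simp,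
      tendsto_pow_atTop two_ne_zero⟩
  have him : Tendsto g (atBot ⊔ atTop) (𝓝 0) :=
    hg ▸ hsq.const_div_atTop c
  rw [tendsto_sup] at him
  refine ⟨fun t => (t : ℂ) + g t * Complex.I, hγ.continuous,
    ⟨∅, Set.countable_empty, fun t _ => hγ.differentiable one_ne_zero t⟩,
    fun s t => (hγ.continuous_deriv le_rfl).intervalIntegrable s t, ?_, ?_, ?_, ?_, ?_⟩
  · exact tendsto_id.congr fun t => by simp
  · exact tendsto_id.congr fun t => by simp
  · simpa using him.2
  · simpa using him.1
  · intro t ht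
    refine hc ⟨_, ht, ?_⟩
    have := hpos t
    simp only [Complex.add_im, Complex.ofReal_im, Complex.mul_im, Complex.I_im, Complex.ofReal_re,
      Complex.I_re, Complex.add_re, Complex.mul_re, hg]
    field_simp
    ring

theorem tendsto_norm_atTop_of_re {ι : Type*} {l : Filter ι} {w : ι → ℂ}
    (hre : Tendsto (fun t => |(w t).re|) l atTop) : Tendsto (fun t => ‖w t‖) l atTop :=
  tendsto_atTop_mono (fun t => Complex.abs_re_le_norm (w t)) hre

theorem tendsto_pow_mul_exp_neg_sq (k : ℕ) :
    Tendsto (fun x : ℝ => x ^ k * Real.exp (-x ^ 2 / 2)) atTop (𝓝 0) := by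
  refine squeeze_zero' ?_ ?_ (Real.tendsto_pow_mul_exp_neg_atTop_nhds_zero k)
  · filter_upwards [eventually_ge_atTop 0] with x hx
    positivity
  · filter_upwards [eventually_ge_atTop 2] with x hx
    have : (0 : ℝ) ≤ x := by linarith
    gcongr
    nlinarith

/-- Since `|exp(-w²/2)| = exp(-|w|²/2) exp((Im w)²)` and `Im w → 0`, the Gaussian decay in `|w|`
dominates every polynomial. -/
theorem tendsto_eval_mul_exp {ι : Type*} {l : Filter ι} {w : ι → ℂ}
    (hre : Tendsto (fun t => |(w t).re|) l atTop) (him : Tendsto (fun t => (w t).im) l (𝓝 0))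
    (P : ℂ[X]) : Tendsto (fun t => P.eval (w t) * Complex.exp (-(w t) ^ 2 / 2)) l (𝓝 0) := by
  induction P using Polynomial.induction_on' with
  | add p q hp hq => simpa [add_mul] using hp.add hq
  | monomial k a =>
    rw [tendsto_zero_iff_norm_tendsto_zero]
    have h1 : ∀ t, ‖(monomial k a).eval (w t) * Complex.exp (-(w t) ^ 2 / 2)‖
        = ‖a‖ * (‖w t‖ ^ k * Real.exp (-‖w t‖ ^ 2 / 2)) * Real.exp ((w t).im ^ 2) := by
      intro t
      have h2 : (-(w t) ^ 2 / 2).re = -‖w t‖ ^ 2 / 2 + (w t).im ^ 2 := by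
        rw [Complex.sq_norm, Complex.normSq_apply]
        simp [pow_two]
        ring
      rw [eval_monomial, norm_mul, norm_mul, norm_pow, Complex.norm_exp, h2, Real.exp_add]
      ring
    simp only [h1]
    have h3 := ((tendsto_pow_mul_exp_neg_sq k).comp (tendsto_norm_atTop_of_re hre)).const_mul ‖a‖
    have h4 : Tendsto (fun t => Real.exp ((w t).im ^ 2)) l (𝓝 (Real.exp (0 ^ 2))) :=
      (Real.continuous_exp.tendsto _).comp (him.pow 2)
    simpa using h3.mul h4

theorem tendsto_eval_div_mul_exp {ι : Type*} {l : Filter ι} {w : ι → ℂ}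
    (hre : Tendsto (fun t => |(w t).re|) l atTop) (him : Tendsto (fun t => (w t).im) l (𝓝 0))
    (A B : ℂ[X]) :
    Tendsto (fun t => A.eval (w t) / B.eval (w t) * Complex.exp (-(w t) ^ 2 / 2)) l (𝓝 0) := by
  -- Only a finite limit of `1 / B` is needed: `0` for nonconstant `B`, its constant value
  -- otherwise.
  obtain ⟨c, hc⟩ : ∃ c, Tendsto (fun t => (B.eval (w t))⁻¹) l (𝓝 c) := by
    rcases le_or_gt B.degree 0 with h | h
    · rw [eq_C_of_degree_le_zero h]
      exact ⟨_, by simpa using tendsto_const_nhds⟩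
    · exact ⟨0, tendsto_inv₀_cobounded.comp (tendsto_norm_atTop_iff_cobounded.mp
        (B.tendsto_norm_atTop h (tendsto_norm_atTop_of_re hre)))⟩
  have := (tendsto_eval_mul_exp hre him A).mul hc
  rw [zero_mul] at this
  refine this.congr fun t => ?_
  ring

theorem differentiable_exp_neg_sq : Differentiable ℂ fun w : ℂ => Complex.exp (-w ^ 2 / 2) := by
  fun_prop

/-- On the vertical segment from `Re w` to `w` the derivative of `G` is at most `exp((Im w)²/2)` in
norm. This moves the endpoints of a path to the real axis. -/
theorem norm_sub_ofReal_re_le {G : ℂ → ℂ}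
    (hG : ∀ w, HasDerivAt G (Complex.exp (-w ^ 2 / 2)) w) (w : ℂ) :
    ‖G w - G w.re‖ ≤ Real.exp (w.im ^ 2 / 2) * |w.im| := by
  have h := (convex_segment (𝕜 := ℝ) (w.re : ℂ) w).norm_image_sub_le_of_norm_hasDerivWithin_le
    (f := G) (f' := fun w => Complex.exp (-w ^ 2 / 2)) (C := Real.exp (w.im ^ 2 / 2))
    (fun x _ => (hG x).hasDerivWithinAt) (fun x hx => ?_) (left_mem_segment ℝ _ _)
    (right_mem_segment ℝ _ _)
  · refine h.trans_eq ?_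
    congr 1
    have : w - w.re = w.im * Complex.I := by
      linear_combination -Complex.re_add_im w
    rw [this]
    simp
  · rw [segment_eq_image'] at hx
    obtain ⟨θ, hθ, rfl⟩ := hx
    rw [Complex.norm_exp]
    apply Real.exp_le_exp.mpr
    have h0 := hθ.1
    have h1 := hθ.2
    simp [pow_two]
    have h2 : θ * w.im * (θ * w.im) ≤ w.im * w.im := by
      have : θ * θ ≤ 1 := by nlinarith
      nlinarith [mul_self_nonneg w.im]
    nlinarith [mul_self_nonneg w.re]

theorem tendsto_primitive_gaussian {G : ℂ → ℂ}
    (hG : ∀ w, HasDerivAt G (Complex.exp (-w ^ 2 / 2)) w) {S : Set ℂ} {γ : ℝ → ℂ}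
    (hγ : IsHermitePath S γ) :
    Tendsto (fun p : ℝ × ℝ => G (γ p.2) - G (γ p.1)) (atBot ×ˢ atTop)
      (𝓝 (Real.sqrt (2 * Real.pi))) := by
  have hv : ∀ {l : Filter ℝ}, Tendsto (fun t => (γ t).im) l (𝓝 0) →
      Tendsto (fun t => G (γ t) - G (γ t).re) l (𝓝 0) := by
    intro l hl
    refine squeeze_zero_norm (fun t => norm_sub_ofReal_re_le hG (γ t)) ?_
    have : Continuous fun v : ℝ => Real.exp (v ^ 2 / 2) * |v| := by fun_prop
    simpa [Function.comp_def] using (this.tendsto 0).comp hl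
  have hint : Integrable fun u : ℝ => Complex.exp (-(u : ℂ) ^ 2 / 2) := by
    have := (integrable_exp_neg_mul_sq (b := 1 / 2) (by norm_num)).ofReal (𝕜 := ℂ)
    refine this.congr (Eventually.of_forall fun u => ?_)
    simp only [Complex.coe_algebraMap, Complex.ofReal_exp]
    congr 1
    push_cast
    ring
  have hval : ∫ u : ℝ, Complex.exp (-(u : ℂ) ^ 2 / 2) = Real.sqrt (2 * Real.pi) := by
    have h1 := integral_gaussian (1 / 2)
    have h2 : ∫ u : ℝ, Complex.exp (-(u : ℂ) ^ 2 / 2)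
        = ∫ u : ℝ, ((Real.exp (-(1 / 2) * u ^ 2) : ℝ) : ℂ) := by
      congr 1
      funext u
      rw [Complex.ofReal_exp]
      congr 1
      push_cast
      ring
    rw [h2, integral_complex_ofReal, h1]
    congr 2
    ring
  have hreal : Tendsto (fun p : ℝ × ℝ => G (γ p.2).re - G (γ p.1).re) (atBot ×ˢ atTop)
      (𝓝 (Real.sqrt (2 * Real.pi))) := by
    have := intervalIntegral_tendsto_integral hint
      (hγ.re_atBot.comp tendsto_fst : Tendsto _ (atBot ×ˢ (atTop : Filter ℝ)) _)
      (hγ.re_atTop.comp tendsto_snd)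
    rw [hval] at this
    refine this.congr fun p => ?_
    rw [intervalIntegral.integral_eq_sub_of_hasDerivAt (f := fun u : ℝ => G u)]
    · rfl
    · intro x _
      exact (hG x).comp_ofReal
    · exact hint.intervalIntegrable
  have := (((hv hγ.im_atTop).comp tendsto_snd).sub ((hv hγ.im_atBot).comp tendsto_fst)).add hreal
  simp only [sub_zero, zero_add] at this
  refine this.congr fun p => ?_
  simp only [Function.comp_apply]
  ring

theorem hermiteWronskian_eq_eval {N : ℕ} (lam : Fin N → ℕ) :
    hermiteWronskian lam = fun x => (pWronskian fun i => hPoly (expo lam i)).eval x := by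
  funext x
  rw [eval_pWronskian, hermiteWronskian]
  simp only [h_eq_eval]

theorem hHat_eq_eval {N : ℕ} (lam : Fin N → ℕ) (n : ℕ) :
    hHat lam n = fun x =>
      (pWronskian (Fin.snoc (fun i => hPoly (expo lam i)) (hPoly n) : Fin (N + 1) → ℂ[X])).eval x /
        (pWronskian fun i => hPoly (expo lam i)).eval x := by
  funext x
  rw [hHat, K, hermiteWronskian_eq_eval, eval_pWronskian]
  congr 2
  funext j
  refine Fin.lastCases ?_ (fun i => ?_) j <;> simp [h_eq_eval]

/-- Off the zeros of `W` the integrand has the primitive `c G + (A/B) exp(-w²/2)`, with `G` an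
entire primitive of the Gaussian. The second term vanishes at both ends; the first contributes `c
√(2π)`. -/
theorem hasHermiteProduct_hHat {N : ℕ} {lam : Fin N → ℕ} (hm : Function.Injective (expo lam))
    (n : ℕ) :
    HasHermiteProduct {x | hermiteWronskian lam x = 0} (hHat lam n) (hHat lam n)
      ((∏ i, ((n : ℂ) - expo lam i)) * (n.factorial : ℂ)⁻¹ * Real.sqrt (2 * Real.pi)) := by
  obtain ⟨hW, hAB⟩ := pWronskian_hPoly hm
  obtain ⟨A, B, -, hB, hrel⟩ := hAB n
  rw [hHat_eq_eval, hermiteWronskian_eq_eval]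
  set W := pWronskian fun i => hPoly (expo lam i)
  set Wn := pWronskian (Fin.snoc (fun i => hPoly (expo lam i)) (hPoly n) : Fin (N + 1) → ℂ[X])
  set c := (∏ i, ((n : ℂ) - expo lam i)) * (n.factorial : ℂ)⁻¹
  refine ⟨exists_isHermitePath (W.finite_setOfPred_isRoot hW), fun γ hγ => ?_⟩
  obtain ⟨G, hG⟩ := differentiable_exp_neg_sq.isExactOn_univ
  replace hG := fun w => hG w (Set.mem_univ w)
  set F : ℂ → ℂ := fun w => c * G w + A.eval w / B.eval w * Complex.exp (-w ^ 2 / 2)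
  have hF : ∀ w ∉ {x | W.eval x = 0}, HasDerivAt F
      (Wn.eval w / W.eval w * (Wn.eval w / W.eval w) * Complex.exp (-w ^ 2 / 2)) w := by
    intro w hw
    have hw : W.eval w ≠ 0 := hw
    have hBw := hB w hw
    have he : HasDerivAt (fun w : ℂ => Complex.exp (-w ^ 2 / 2))
        (Complex.exp (-w ^ 2 / 2) * (-w)) w := by
      have h1 : HasDerivAt (fun w : ℂ => -w ^ 2 / 2) (-w) w := by
        refine (((hasDerivAt_id w).pow 2).neg.div_const 2).congr_deriv ?_
        simp
        ring
      exact h1.cexp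
    refine (((hG w).const_mul c).add (((A.hasDerivAt w).div (B.hasDerivAt w) hBw).mul he)).congr_deriv
      ?_
    have h2 := congrArg (eval w) hrel
    simp only [eval_mul, eval_pow, eval_add, eval_sub, eval_C, eval_X] at h2
    rw [Pi.div_apply]
    field_simp
    linear_combination -h2
  have hcont : ContinuousOn (fun w => Wn.eval w / W.eval w * (Wn.eval w / W.eval w)
      * Complex.exp (-w ^ 2 / 2)) {x | W.eval x = 0}ᶜ := by
    have h1 : ContinuousOn (fun w => Wn.eval w / W.eval w) {x | W.eval x = 0}ᶜ :=
      Wn.continuous.continuousOn.div W.continuous.continuousOn fun x hx => hx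
    exact (h1.mul h1).mul differentiable_exp_neg_sq.continuous.continuousOn
  have hT := (tendsto_eval_div_mul_exp (tendsto_abs_atTop_atTop.comp hγ.re_atTop) hγ.im_atTop A B)
  have hB' := (tendsto_eval_div_mul_exp (tendsto_abs_atBot_atTop.comp hγ.re_atBot) hγ.im_atBot A B)
  have := ((tendsto_primitive_gaussian hG hγ).const_mul c).add
    ((hT.comp tendsto_snd).sub (hB'.comp tendsto_fst))
  simp only [sub_zero, add_zero] at this
  refine this.congr fun p => ?_
  rw [integral_comp_mul_deriv_of_isHermitePath hγ hF hcont]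
  simp only [F, Function.comp_apply]
  ring

end KPHermite

/-! ### The functions `κᵢ` and the operators that annihilate them. -/

namespace KPHermite

section Kappa

open Polynomial

theorem hasDerivAt_psi0 (x y z : ℂ) :
    HasDerivAt (psi0 x y) ((x + 2 * y * z) * psi0 x y z) z := by
  have h1 : HasDerivAt (fun z : ℂ => x * z + y * z ^ 2) (x + 2 * y * z) z := by
    refine (((hasDerivAt_id z).const_mul x).add (((hasDerivAt_id z).pow 2).const_mul y)).congr_deriv
      ?_
    simp
    ring
  exact h1.cexp.congr_deriv (by rw [psi0]; ring)

theorem contDiff_psi0 (x y : ℂ) : ContDiff ℂ ⊤ (psi0 x y) := by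
  unfold psi0
  fun_prop

theorem iteratedDeriv_psi0_add_two (x y : ℂ) (n : ℕ) (z : ℂ) :
    iteratedDeriv (n + 2) (psi0 x y) z = (x + 2 * y * z) * iteratedDeriv (n + 1) (psi0 x y) z
      + 2 * y * (n + 1) * iteratedDeriv n (psi0 x y) z := by
  have hlin (z : ℂ) : HasDerivAt (fun z : ℂ => x + 2 * y * z) (2 * y) z := by
    simpa using ((hasDerivAt_id z).const_mul (2 * y)).const_add x
  have hit (k : ℕ) (z : ℂ) :
      HasDerivAt (iteratedDeriv k (psi0 x y)) (iteratedDeriv (k + 1) (psi0 x y) z) z := by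
    rw [iteratedDeriv_succ]
    exact ((contDiff_psi0 x y).differentiable_iteratedDeriv k
      (WithTop.coe_lt_top _) z).hasDerivAt
  induction n generalizing z with
  | zero =>
    have h1 : iteratedDeriv 1 (psi0 x y) = fun z => (x + 2 * y * z) * psi0 x y z := by
      rw [iteratedDeriv_one]
      exact funext fun z => (hasDerivAt_psi0 x y z).deriv
    rw [iteratedDeriv_succ, h1]
    refine ((hlin z).mul (hasDerivAt_psi0 x y z)).deriv.trans ?_
    simp
    ring
  | succ n ih =>
    rw [iteratedDeriv_succ, funext ih]
    refine (((hlin z).mul (hit (n + 1) z)).add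
      ((hit n z).const_mul (2 * y * ((n : ℂ) + 1)))).deriv.trans ?_
    beta_reduce
    push_cast
    linear_combination (x + 2 * y * z) * ih z

/-- The coefficients of `psi0 x y z` as a power series in `z`, as polynomials in `x`. -/
noncomputable def psiCoeff (y : ℂ) : ℕ → ℂ[X]
  | 0 => 1
  | 1 => X
  | n + 2 => C ((n + 2 : ℂ)⁻¹) * (X * psiCoeff y (n + 1) + C (2 * y) * psiCoeff y n)

theorem psiCoeff_add_two (y : ℂ) (n : ℕ) :
    ((n : ℂ[X]) + 2) * psiCoeff y (n + 2) = X * psiCoeff y (n + 1) + C (2 * y) * psiCoeff y n := by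
  have h : ((n : ℂ) + 2) ≠ 0 := by exact_mod_cast (Nat.succ_ne_zero (n + 1))
  have h2 : ((n : ℂ[X]) + 2) * C ((n + 2 : ℂ)⁻¹) = 1 := by
    rw [show ((n : ℂ[X]) + 2) = C ((n : ℂ) + 2) by simp [map_ofNat C], ← C_mul, mul_inv_cancel₀ h, C_1]
  rw [psiCoeff, ← mul_assoc, h2, one_mul]

theorem eval_psiCoeff_add_two (x y : ℂ) (n : ℕ) :
    ((n : ℂ) + 2) * (psiCoeff y (n + 2)).eval x
      = x * (psiCoeff y (n + 1)).eval x + 2 * y * (psiCoeff y n).eval x := by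
  simpa using congrArg (eval x) (psiCoeff_add_two y n)

theorem derivative_psiCoeff_succ (y : ℂ) (n : ℕ) :
    derivative (psiCoeff y (n + 1)) = psiCoeff y n := by
  induction n using Nat.twoStepInduction with
  | zero => simp [psiCoeff]
  | one =>
    have h := congrArg derivative (psiCoeff_add_two y 0)
    simp [psiCoeff] at h ⊢
    apply mul_left_cancel₀ (two_ne_zero (α := ℂ[X]))
    linear_combination h
  | more n ih1 ih2 =>
    have h := congrArg derivative (psiCoeff_add_two y (n + 1))
    have h0 : ((n : ℂ[X]) + 3) ≠ 0 := by exact_mod_cast (Nat.succ_ne_zero (n + 2))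
    have h2 : derivative ((n : ℂ[X]) + 1 + 2) = 0 := by simp
    push_cast at h
    rw [derivative_mul, h2, zero_mul, zero_add, derivative_add, derivative_mul, derivative_X,
      one_mul, derivative_C_mul, ih1, ih2] at h
    have h3 := psiCoeff_add_two y n
    apply mul_left_cancel₀ h0
    linear_combination h - h3

theorem iterate_derivative_psiCoeff (y : ℂ) (m i : ℕ) :
    derivative^[i] (psiCoeff y m) = if i ≤ m then psiCoeff y (m - i) else 0 := by
  induction i with
  | zero => simp
  | succ i ih =>
    rw [Function.iterate_succ_apply', ih]
    by_cases h : i + 1 ≤ m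
    · rw [if_pos h, if_pos (by omega), show m - i = (m - (i + 1)) + 1 by omega,
        derivative_psiCoeff_succ]
    · rw [if_neg h]
      by_cases h' : i ≤ m
      · rw [if_pos h', show m - i = 0 by omega]
        simp [psiCoeff]
      · simp [h']

theorem iteratedDeriv_psi0_zero (x y : ℂ) (n : ℕ) :
    iteratedDeriv n (psi0 x y) 0 = n.factorial * (psiCoeff y n).eval x := by
  induction n using Nat.twoStepInduction with
  | zero => simp [psiCoeff, psi0]
  | one =>
    rw [iteratedDeriv_one, (hasDerivAt_psi0 x y 0).deriv]
    simp [psiCoeff, psi0]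
  | more n ih1 ih2 =>
    rw [iteratedDeriv_psi0_add_two, ih1, ih2]
    have := eval_psiCoeff_add_two x y n
    simp only [Nat.factorial_succ]
    push_cast
    linear_combination (-(n + 1) * (n.factorial : ℂ)) * this

theorem kappa_eq_eval {N : ℕ} (lam : Fin N → ℕ) (y : ℂ) (i : Fin N) :
    kappa lam y i = fun x => (C ((expo lam i).factorial : ℂ) * psiCoeff y (expo lam i)).eval x := by
  funext x
  rw [kappa, iteratedDeriv_psi0_zero]
  simp

theorem iteratedDeriv_kappa {N : ℕ} (lam : Fin N → ℕ) (x y : ℂ) (i : Fin N) (j : ℕ) :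
    iteratedDeriv j (kappa lam y i) x = (expo lam i).factorial *
      if j ≤ expo lam i then (psiCoeff y (expo lam i - j)).eval x else 0 := by
  rw [kappa_eq_eval, iteratedDeriv_eval, iterate_derivative_C_mul, iterate_derivative_psiCoeff]
  split_ifs <;> simp

theorem iteratedDeriv_psi0_left (y z : ℂ) (j : ℕ) (x : ℂ) :
    iteratedDeriv j (fun s => psi0 s y z) x = z ^ j * psi0 x y z := by
  induction j generalizing x with
  | zero => simp
  | succ j ih =>
    rw [iteratedDeriv_succ, funext ih]
    have h1 : HasDerivAt (fun s : ℂ => s * z + y * z ^ 2) z x := by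
      simpa using ((hasDerivAt_id x).mul_const z).add_const (y * z ^ 2)
    have h2 : HasDerivAt (fun s => z ^ j * psi0 s y z) (z ^ j * (psi0 x y z * z)) x :=
      h1.cexp.const_mul (z ^ j)
    rw [h2.deriv]
    ring

/-- If the last row of the Wronskian matrix of `f₁, …, f_N, g` can be cleared by a combination of
the rows, then the Wronskian factors. -/
theorem wronskian_snoc_of_combination {N : ℕ} (f : Fin N → ℂ → ℂ) (g : ℂ → ℂ) (x : ℂ) (c : ℕ → ℂ)
    (hf : ∀ i, iteratedDeriv N (f i) x + ∑ j ∈ Finset.range N, c j * iteratedDeriv j (f i) x = 0) :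
    wronskian (Fin.snoc (α := fun _ => ℂ → ℂ) f g) x
      = (iteratedDeriv N g x + ∑ j ∈ Finset.range N, c j * iteratedDeriv j g x)
        * wronskian f x := by
  rw [wronskian]
  set A : Matrix (Fin (N + 1)) (Fin (N + 1)) ℂ := Matrix.of fun i j =>
    iteratedDeriv i ((Fin.snoc (α := fun _ => ℂ → ℂ) f g : Fin (N + 1) → ℂ → ℂ) j) x with hA
  -- The last row has weight `1`, so replacing it by this combination keeps the determinant and
  -- leaves only its corner entry.
  set d : Fin (N + 1) → ℂ := fun j => if (j : ℕ) < N then c j else 1 with hd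
  have h1 := Matrix.det_updateRow_sum A (Fin.last N) d
  have hrow : ∀ j, (∑ k, d k • A k) j
      = iteratedDeriv N ((Fin.snoc (α := fun _ => ℂ → ℂ) f g : Fin (N + 1) → ℂ → ℂ) j) x
        + ∑ k ∈ Finset.range N,
          c k * iteratedDeriv k ((Fin.snoc (α := fun _ => ℂ → ℂ) f g : Fin (N + 1) → ℂ → ℂ) j) x := by
    intro j
    rw [Fin.sum_univ_castSucc, Pi.add_apply, Finset.sum_apply, add_comm]
    congr 1
    · simp [hd, hA]
    · rw [← Fin.sum_univ_eq_sum_range (fun k => c k * iteratedDeriv k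
        ((Fin.snoc (α := fun _ => ℂ → ℂ) f g : Fin (N + 1) → ℂ → ℂ) j) x)]
      refine Finset.sum_congr rfl fun k _ => ?_
      simp [hd, hA]
  rw [show d (Fin.last N) = 1 by simp [hd], one_smul] at h1
  rw [← h1, Matrix.det_succ_row _ (Fin.last N), Fin.sum_univ_castSucc]
  rw [Finset.sum_eq_zero, zero_add]
  · rw [Matrix.updateRow_self, hrow, Fin.snoc_last, Fin.val_last, ← two_mul, pow_mul]
    simp only [even_two, Even.neg_pow, one_pow, one_mul]
    congr 1
    rw [wronskian]
    congr 1
    ext i j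
    simp [hA, Fin.succAbove_last, Fin.castSucc_ne_last]
  · intro i _
    rw [Matrix.updateRow_self, hrow, Fin.snoc_castSucc, hf]
    simp

end Kappa

/-! ### A criterion for Calogero-Moser matrices to represent the partition. -/

section Criterion

variable {N : ℕ} (C : CalogeroMoser N)

theorem CalogeroMoser.X_mulVec_pow (v : Fin N → ℂ) (j : ℕ) :
    C.X *ᵥ (C.Z ^ j *ᵥ v) = C.Z ^ j *ᵥ (C.X *ᵥ v) + (j : ℂ) • (C.Z ^ (j - 1) *ᵥ v)
      + ∑ i ∈ Finset.range j, (C.a ⬝ᵥ (C.Z ^ i *ᵥ v)) • (C.Z ^ (j - 1 - i) *ᵥ C.b) := by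
  have hcomm (w : Fin N → ℂ) : C.X *ᵥ (C.Z *ᵥ w) = C.Z *ᵥ (C.X *ᵥ w) + w + (C.a ⬝ᵥ w) • C.b := by
    have h := congrArg (· *ᵥ w) C.rank_one
    simp only [Matrix.sub_mulVec, Matrix.one_mulVec, ← Matrix.mulVec_mulVec,
      Matrix.vecMulVec_mulVec] at h
    rw [sub_sub, sub_eq_iff_eq_add] at h
    rw [h]
    ext i
    simp
    ring
  induction j with
  | zero => simp
  | succ j ih =>
    rw [pow_succ', ← Matrix.mulVec_mulVec, hcomm, ih, Finset.sum_range_succ]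
    simp only [Matrix.mulVec_add, Matrix.mulVec_smul, Matrix.mulVec_sum, Matrix.mulVec_mulVec,
      Nat.add_sub_cancel, Nat.sub_self, pow_zero, Matrix.one_mulVec, ← pow_succ', ← mul_assoc]
    have h1 : ∑ i ∈ Finset.range j, (C.a ⬝ᵥ (C.Z ^ i *ᵥ v)) • (C.Z ^ (j - 1 - i + 1) *ᵥ C.b)
        = ∑ i ∈ Finset.range j, (C.a ⬝ᵥ (C.Z ^ i *ᵥ v)) • (C.Z ^ (j - i) *ᵥ C.b) := by
      refine Finset.sum_congr rfl fun i hi => ?_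
      rw [Finset.mem_range] at hi
      rw [show j - 1 - i + 1 = j - i by omega]
    have h2 : (j : ℂ) • (C.Z ^ (j - 1 + 1) *ᵥ v) = (j : ℂ) • (C.Z ^ j *ᵥ v) := by
      rcases j with _ | j
      · simp
      · rfl
    rw [h1, h2]
    push_cast
    rw [add_smul, one_smul]
    abel

/-- The partial sums that express `(d/dZ - x - 2 y Z) exp (x Z + y Z ^ 2) = 0`. -/
theorem CalogeroMoser.sum_telescope (v : Fin N → ℂ) (x y : ℂ) (n : ℕ) :
    ∑ j ∈ Finset.range (n + 1), (psiCoeff y j).eval x • (x • (C.Z ^ j *ᵥ v)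
        + (2 * y) • (C.Z ^ (j + 1) *ᵥ v) - (j : ℂ) • (C.Z ^ (j - 1) *ᵥ v))
      = ((n + 1 : ℂ) * (psiCoeff y (n + 1)).eval x) • (C.Z ^ n *ᵥ v)
        + (2 * y * (psiCoeff y n).eval x) • (C.Z ^ (n + 1) *ᵥ v) := by
  induction n with
  | zero => simp [psiCoeff]
  | succ n ih =>
    have h := eval_psiCoeff_add_two x y n
    rw [Finset.sum_range_succ, ih]
    push_cast
    rw [show ((n : ℂ) + 1 + 1) * (psiCoeff y (n + 1 + 1)).eval x
      = x * (psiCoeff y (n + 1)).eval x + 2 * y * (psiCoeff y n).eval x by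
        rw [← h]; ring]
    module

theorem CalogeroMoser.tildeX_mulVec (x y : ℂ) (v : Fin N → ℂ) :
    C.tildeX x y *ᵥ v = x • v + (2 * y) • (C.Z *ᵥ v) - C.X *ᵥ v := by
  simp [tildeX, Matrix.sub_mulVec, Matrix.add_mulVec, Matrix.smul_mulVec]

/-- A vector `v` such that `aᵀ Z ^ k v = - δ_{k, m - N}` for all `k` and `X v = - Z ^ (N - 1 - m) b`
(to be read as `0` for `m ≥ N`). -/
structure CalogeroMoser.IsAdapted (m : ℕ) (v : Fin N → ℂ) : Prop where
  dot : ∀ k, C.a ⬝ᵥ (C.Z ^ k *ᵥ v) = if k + N = m then -1 else 0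
  mulVec : C.X *ᵥ v = if m < N then -(C.Z ^ (N - 1 - m) *ᵥ C.b) else 0

variable {C}

theorem CalogeroMoser.IsAdapted.X_mulVec_pow {m : ℕ} {v : Fin N → ℂ} (hv : C.IsAdapted m v)
    (j : ℕ) : C.X *ᵥ (C.Z ^ j *ᵥ v) = (j : ℂ) • (C.Z ^ (j - 1) *ᵥ v)
      - if m < N + j then C.Z ^ (N + j - 1 - m) *ᵥ C.b else 0 := by
  rw [C.X_mulVec_pow, hv.mulVec]
  simp only [hv.dot]
  by_cases hm : m < N
  · rw [if_pos hm, if_pos (by omega), Finset.sum_eq_zero]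
    · rw [Matrix.mulVec_neg, Matrix.mulVec_mulVec, ← pow_add,
        show j + (N - 1 - m) = N + j - 1 - m by omega]
      abel
    · intro i _
      rw [if_neg (by omega), zero_smul]
  · rw [if_neg hm, Matrix.mulVec_zero, zero_add, sub_eq_add_neg]
    congr 1
    by_cases hj : m < N + j
    · rw [if_pos hj, Finset.sum_eq_single (m - N)]
      · rw [if_pos (by omega), neg_one_smul, show j - 1 - (m - N) = N + j - 1 - m by omega]
      · intro i _ hi
        rw [if_neg (by omega), zero_smul]
      · intro h
        exact absurd (Finset.mem_range.mpr (by omega)) h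
    · rw [if_neg hj, neg_zero]
      refine Finset.sum_eq_zero fun i hi => ?_
      rw [Finset.mem_range] at hi
      rw [if_neg (by omega), zero_smul]

/-- `V` below is a truncation of `exp(xZ + yZ²) v`. The matrix `tildeX` sends it to a combination of
the `Z^k b`, because `X` acts like `d/dZ` up to multiples of these vectors. Inverting `tildeX` and
pairing with `a` says that `∂^N + ∑ w_k ∂^(N-1-k)` annihilates `psiCoeff y m`, where `w_k = aᵀ
tildeX⁻¹ Z^k b`. -/
theorem CalogeroMoser.IsAdapted.dot_inv_tildeX {m : ℕ} {v : Fin N → ℂ} (hv : C.IsAdapted m v)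
    (hZ : C.Z ^ N = 0) {x y : ℂ} (hx : C.tau x y ≠ 0) :
    (if N ≤ m then (psiCoeff y (m - N)).eval x else 0) + ∑ k ∈ Finset.range N,
      (C.a ⬝ᵥ ((C.tildeX x y)⁻¹ *ᵥ (C.Z ^ k *ᵥ C.b))) *
        (if N ≤ m + 1 + k then (psiCoeff y (m + 1 + k - N)).eval x else 0) = 0 := by
  have hZ' : ∀ k, N ≤ k → C.Z ^ k = 0 := fun k hk => pow_eq_zero_of_le hk hZ
  -- Long enough for both boundary terms of the telescoping sum to contain a power of `Z` of
  -- exponent at least `N`.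
  set L := N + m + 1 with hL
  set V : Fin N → ℂ := ∑ j ∈ Finset.range L, (psiCoeff y j).eval x • (C.Z ^ j *ᵥ v) with hV
  have h1 : C.tildeX x y *ᵥ V = ∑ k ∈ Finset.range N,
      (if N ≤ m + 1 + k then (psiCoeff y (m + 1 + k - N)).eval x else 0) • (C.Z ^ k *ᵥ C.b) := by
    have h2 : C.tildeX x y *ᵥ V = ∑ j ∈ Finset.range L, (psiCoeff y j).eval x •
          (x • (C.Z ^ j *ᵥ v) + (2 * y) • (C.Z ^ (j + 1) *ᵥ v) - (j : ℂ) • (C.Z ^ (j - 1) *ᵥ v))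
        + ∑ j ∈ Finset.range L, (psiCoeff y j).eval x •
          (if m < N + j then C.Z ^ (N + j - 1 - m) *ᵥ C.b else 0) := by
      rw [hV, Matrix.mulVec_sum, ← Finset.sum_add_distrib]
      refine Finset.sum_congr rfl fun j _ => ?_
      rw [Matrix.mulVec_smul, C.tildeX_mulVec, hv.X_mulVec_pow, ← smul_add, Matrix.mulVec_mulVec,
        ← pow_succ']
      congr 1
      abel
    rw [h2, hL, C.sum_telescope, hZ' _ (by omega), hZ' _ (by omega)]
    simp only [Matrix.zero_mulVec, smul_zero, zero_add, smul_ite, ite_smul, zero_smul]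
    rw [← Finset.sum_filter, ← Finset.sum_filter]
    symm
    refine Finset.sum_bij_ne_zero (fun k _ _ => m + 1 + k - N) ?_ ?_ ?_ ?_
    · intro k hk _
      simp only [Finset.mem_filter, Finset.mem_range] at hk ⊢
      omega
    · intro k hk _ k' hk' _ h
      simp only [Finset.mem_filter, Finset.mem_range] at hk hk'
      omega
    · intro j hj hne
      simp only [Finset.mem_filter, Finset.mem_range] at hj
      have hlt : N + j - 1 - m < N := by
        by_contra hcon
        rw [hZ' _ (by omega)] at hne
        simp at hne
      have he : m + 1 + (N + j - 1 - m) - N = j := by omega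
      refine ⟨N + j - 1 - m, ?_, ?_, he⟩
      · simp only [Finset.mem_filter, Finset.mem_range]
        omega
      · rw [he]
        exact hne
    · intro k hk _
      simp only [Finset.mem_filter, Finset.mem_range] at hk
      rw [show N + (m + 1 + k - N) - 1 - m = k by omega]
  have h3 : C.a ⬝ᵥ V = -(if N ≤ m then (psiCoeff y (m - N)).eval x else 0) := by
    rw [hV, dotProduct_sum]
    simp only [dotProduct_smul, hv.dot, smul_eq_mul]
    by_cases hm : N ≤ m
    · rw [if_pos hm, Finset.sum_eq_single (m - N)]
      · rw [if_pos (by omega)]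
        ring
      · intro j _ hj
        rw [if_neg (by omega), mul_zero]
      · intro h
        exact absurd (Finset.mem_range.mpr (by omega)) h
    · rw [if_neg hm, neg_zero]
      exact Finset.sum_eq_zero fun j _ => by rw [if_neg (by omega), mul_zero]
  have hu : IsUnit (C.tildeX x y).det := isUnit_iff_ne_zero.mpr hx
  have h4 : V = ∑ k ∈ Finset.range N,
      (if N ≤ m + 1 + k then (psiCoeff y (m + 1 + k - N)).eval x else 0) •
        ((C.tildeX x y)⁻¹ *ᵥ (C.Z ^ k *ᵥ C.b)) := by
    have := congrArg ((C.tildeX x y)⁻¹ *ᵥ ·) h1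
    simp only [Matrix.mulVec_mulVec, Matrix.nonsing_inv_mul _ hu, Matrix.one_mulVec,
      Matrix.mulVec_sum, Matrix.mulVec_smul] at this
    simpa only [Matrix.mulVec_mulVec] using this
  rw [h4, dotProduct_sum] at h3
  rw [← neg_eq_iff_eq_neg.mpr h3]
  simp only [dotProduct_smul, smul_eq_mul]
  rw [neg_add_eq_zero]
  exact Finset.sum_congr rfl fun k _ => mul_comm _ _

theorem CalogeroMoser.inv_tildeZ (hZ : C.Z ^ N = 0) {z : ℂ} (hz : z ≠ 0) :
    (C.tildeZ z)⁻¹ = ∑ k ∈ Finset.range N, (z⁻¹ ^ (k + 1)) • C.Z ^ k := by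
  apply Matrix.inv_eq_right_inv
  have h : (∑ k ∈ Finset.range N, (z⁻¹ ^ (k + 1)) • C.Z ^ k)
      = z⁻¹ • ∑ k ∈ Finset.range N, (z⁻¹ • C.Z) ^ k := by
    rw [Finset.smul_sum]
    refine Finset.sum_congr rfl fun k _ => ?_
    rw [smul_pow, smul_smul, pow_succ']
  have h2 : C.tildeZ z = z • (1 - z⁻¹ • C.Z) := by
    rw [tildeZ, smul_sub, smul_smul, mul_inv_cancel₀ hz, one_smul]
  rw [h, h2, smul_mul_smul_comm, mul_inv_cancel₀ hz, one_smul, mul_neg_geom_sum, smul_pow, hZ]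
  simp

/-- For nilpotent `Z` the Neumann series gives `ψ_C = z^(-N) T ψ₀` with `T = ∂^N + ∑ w_k ∂^(N-1-k)`.
By `dot_inv_tildeX`, `T` annihilates every `κᵢ`, hence `T ψ₀ = Wr(κ, ψ₀) / Wr(κ)`. -/
theorem isPartitionPoint_of_isAdapted {lam : Fin N → ℕ} (hZ : C.Z ^ N = 0)
    (hv : ∀ i, ∃ v, C.IsAdapted (expo lam i) v) : IsPartitionPoint lam C := by
  intro x y z hx _ hz hW
  set w : ℕ → ℂ := fun k => C.a ⬝ᵥ ((C.tildeX x y)⁻¹ *ᵥ (C.Z ^ k *ᵥ C.b)) with hw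
  have hpsi : C.psi x y z = (1 + ∑ k ∈ Finset.range N, z⁻¹ ^ (k + 1) * w k) * psi0 x y z := by
    rw [CalogeroMoser.psi, C.inv_tildeZ hZ hz]
    simp only [Matrix.sum_mulVec, Matrix.mulVec_sum, dotProduct_sum, Matrix.smul_mulVec,
      Matrix.mulVec_smul, dotProduct_smul, smul_eq_mul, hw]
  have hrefl : ∀ g : ℕ → ℂ, ∑ j ∈ Finset.range N, w (N - 1 - j) * g j
      = ∑ k ∈ Finset.range N, w k * g (N - 1 - k) := by
    intro g
    rw [← Finset.sum_range_reflect]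
    refine Finset.sum_congr rfl fun k hk => ?_
    rw [Finset.mem_range] at hk
    rw [show N - 1 - (N - 1 - k) = k by omega]
  have hsnoc := wronskian_snoc_of_combination (kappa lam y) (fun s => psi0 s y z) x
    (fun j => w (N - 1 - j)) (by
      intro i
      obtain ⟨v, hv⟩ := hv i
      have h1 := hv.dot_inv_tildeX hZ hx
      rw [hrefl (fun j => iteratedDeriv j (kappa lam y i) x)]
      simp only [iteratedDeriv_kappa]
      refine Eq.trans ?_ ((congrArg (((expo lam i).factorial : ℂ) * ·) h1).trans (mul_zero _))
      rw [mul_add, Finset.mul_sum]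
      refine congrArg₂ (· + ·) rfl (Finset.sum_congr rfl fun k hk => ?_)
      rw [Finset.mem_range] at hk
      by_cases hc : N ≤ expo lam i + 1 + k
      · rw [if_pos hc, if_pos (by omega),
          show expo lam i - (N - 1 - k) = expo lam i + 1 + k - N by omega]
        ring
      · rw [if_neg hc, if_neg (by omega)]
        ring)
  rw [psiLam, hsnoc, mul_div_mul_right _ _ hW, hpsi]
  rw [hrefl (fun j => iteratedDeriv j (fun s => psi0 s y z) x)]
  simp only [iteratedDeriv_psi0_left]
  rw [eq_div_iff (pow_ne_zero _ hz)]
  have h5 : ∀ k ∈ Finset.range N, w k * (z ^ (N - 1 - k) * psi0 x y z)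
      = (z⁻¹ ^ (k + 1) * w k) * psi0 x y z * z ^ N := by
    intro k hk
    rw [Finset.mem_range] at hk
    have : z ^ N = z ^ (N - 1 - k) * z ^ (k + 1) := by
      rw [← pow_add]
      congr 1
      omega
    rw [this, inv_pow]
    field_simp
  rw [Finset.sum_congr rfl h5, ← Finset.sum_mul, ← Finset.sum_mul]
  ring

end Criterion

end KPHermite

namespace KPHermite

/-! ### Invertibility of Cauchy matrices. -/

section Cauchy

open Polynomial

/-- A Cauchy matrix `1 / (p_i + q_j + 1)` is invertible. -/
theorem isUnit_det_cauchy {r : ℕ} {p q : Fin r → ℕ} (hp : Function.Injective p)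
    (hq : Function.Injective q) :
    IsUnit (Matrix.of fun j i : Fin r => ((p i : ℂ) + q j + 1)⁻¹).det := by
  rw [isUnit_iff_ne_zero]
  intro hdet
  obtain ⟨v, hv0, hv⟩ := Matrix.exists_mulVec_eq_zero_iff.mpr hdet
  apply hv0
  have hne : ∀ i (j : Fin r), (p i : ℂ) + q j + 1 ≠ 0 := fun i j => by
    exact_mod_cast Nat.succ_ne_zero (p i + q j)
  -- The numerator of `∑ vᵢ / (x + pᵢ + 1)`: its degree is below `r` and it vanishes at the `r`
  -- points `q_j`, so it is zero. Its value at `-pᵢ - 1` is a nonzero multiple of `vᵢ`.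
  set f : ℂ[X] := ∑ i, C (v i) * ∏ l ∈ Finset.univ.erase i, (X + C ((p l : ℂ) + 1)) with hf
  have hdeg : f.degree < (Finset.univ.image fun j => (q j : ℂ)).card := by
    rw [Finset.card_image_of_injective _
      (show Function.Injective fun j => (q j : ℂ) from Nat.cast_injective.comp hq), Finset.card_univ,
      Fintype.card_fin]
    rcases Nat.eq_zero_or_pos r with rfl | hr
    · simp [hf]
    refine lt_of_le_of_lt (degree_sum_le _ _) ?_
    rw [Finset.sup_lt_iff (by exact_mod_cast WithBot.bot_lt_coe r)]
    intro i _
    rw [C_mul']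
    refine lt_of_le_of_lt (degree_smul_le _ _) ?_
    rw [degree_prod]
    simp only [degree_X_add_C, Finset.sum_const, Finset.card_erase_of_mem (Finset.mem_univ i),
      Finset.card_univ, Fintype.card_fin, nsmul_eq_mul, mul_one]
    exact_mod_cast Nat.sub_lt hr one_pos
  have hroot : ∀ x ∈ Finset.univ.image fun j => (q j : ℂ), f.eval x = 0 := by
    intro x hx
    obtain ⟨j, -, rfl⟩ := Finset.mem_image.mp hx
    have h1 := congrFun hv j
    simp only [Matrix.mulVec, dotProduct, Matrix.of_apply, Pi.zero_apply] at h1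
    have h2 : f.eval (q j : ℂ)
        = (∏ l, ((p l : ℂ) + q j + 1)) * ∑ i, ((p i : ℂ) + q j + 1)⁻¹ * v i := by
      rw [hf, eval_finsetSum, Finset.mul_sum]
      refine Finset.sum_congr rfl fun i _ => ?_
      rw [← Finset.mul_prod_erase _ _ (Finset.mem_univ i), eval_mul, eval_prod, eval_C]
      have h3 : ∏ l ∈ Finset.univ.erase i, eval (q j : ℂ) (X + C ((p l : ℂ) + 1))
          = ∏ l ∈ Finset.univ.erase i, ((p l : ℂ) + q j + 1) := by
        refine Finset.prod_congr rfl fun l _ => ?_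
        simp
        ring
      rw [h3]
      have := hne i j
      field_simp
    rw [h2, h1, mul_zero]
  have hf0 : f = 0 := eq_zero_of_degree_lt_of_eval_finset_eq_zero _ hdeg hroot
  funext i
  have h4 := congrArg (eval (-(p i : ℂ) - 1)) hf0
  rw [hf, eval_finsetSum, Finset.sum_eq_single i, eval_mul, eval_prod, eval_C, eval_zero] at h4
  · refine (mul_eq_zero.mp h4).resolve_right (Finset.prod_ne_zero_iff.mpr fun l hl => ?_)
    simp only [eval_add, eval_X, eval_C]
    intro h5
    have : (p l : ℂ) = p i := by linear_combination h5
    exact (Finset.mem_erase.mp hl).1 (hp (Nat.cast_injective this))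
  · intro l _ hl
    rw [eval_mul, eval_prod, Finset.prod_eq_zero (Finset.mem_erase.mpr ⟨hl.symm, Finset.mem_univ i⟩),
      mul_zero]
    simp
  · simp

end Cauchy

/-! ### Calogero-Moser matrices built from hooks. -/

/-- A graded module over the operators `X`, `Z` with a basis of vectors `E i c` (`0 ≤ c ≤ p i`)
of degree `c` and `F j k` (`1 ≤ k ≤ q j`) of degree `-k`; the vectors `E i 0` and `F j 0` are two
bases of the part of degree `0`, which are related by a Cauchy matrix. -/
structure HookModule (V : Type*) [AddCommGroup V] [Module ℂ V] {r : ℕ} (p q : Fin r → ℕ) where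
  E : Fin r → ℕ → V
  F : Fin r → ℕ → V
  X : Module.End ℂ V
  Z : Module.End ℂ V
  A : V →ₗ[ℂ] ℂ
  hom_ext : ∀ f g : Module.End ℂ V, (∀ i c, c ≤ p i → f (E i c) = g (E i c)) →
    (∀ j k, k < q j → f (F j (k + 1)) = g (F j (k + 1))) → f = g
  E_zero : ∀ i, E i 0 = ∑ j, ((p i : ℂ) + q j + 1)⁻¹ • F j 0
  F_eq_zero : ∀ j k, q j ≤ k → F j (k + 1) = 0
  X_E : ∀ i c, c ≤ p i → X (E i c) = ((p i : ℂ) - c) • E i (c + 1)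
  X_F : ∀ j k, k < q j → X (F j (k + 1)) = F j k
  Z_E : ∀ i c, c < p i → Z (E i (c + 1)) = E i c
  Z_F : ∀ j k, Z (F j k) = -((q j : ℂ) - k) • F j (k + 1)
  A_E_zero : ∀ i, A (E i 0) = 1
  A_E : ∀ i c, A (E i (c + 1)) = 0
  A_F : ∀ j k, A (F j (k + 1)) = 0

theorem nonempty_hookModule {r N : ℕ} {p q : Fin r → ℕ} (hp : Function.Injective p)
    (hq : Function.Injective q) (hN : ∑ i, (p i + 1 + q i) = N) :
    Nonempty (HookModule (Fin N → ℂ) p q) := by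
  let ι := (Σ i : Fin r, Fin (p i + 1)) ⊕ (Σ j : Fin r, Fin (q j))
  have hcard : Fintype.card (Fin N) = Fintype.card ι := by
    simp [ι, ← hN, Finset.sum_add_distrib]
  let b : Module.Basis ι ℂ (Fin N → ℂ) := (Pi.basisFun ℂ (Fin N)).reindex (Fintype.equivOfCardEq hcard)
  set G : Matrix (Fin r) (Fin r) ℂ := Matrix.of fun j i => ((p i : ℂ) + q j + 1)⁻¹ with hG
  have hdet : IsUnit G.det := isUnit_det_cauchy hp hq
  let E : Fin r → ℕ → Fin N → ℂ := fun i c =>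
    if h : c < p i + 1 then b (Sum.inl ⟨i, c, h⟩) else 0
  -- The basis vector with index `(j, k)` is `F j (k + 1)`. The vectors `F j 0` are not basis
  -- elements: the inverse Cauchy matrix defines them from the `E i 0`.
  let F : Fin r → ℕ → Fin N → ℂ := fun j k => Nat.casesOn k (∑ i, G⁻¹ i j • E i 0)
    fun k => if h : k < q j then b (Sum.inr ⟨j, k, h⟩) else 0
  have hF0 (j) : F j 0 = ∑ i, G⁻¹ i j • E i 0 := rfl
  have hF1 (j k) : F j (k + 1) = if h : k < q j then b (Sum.inr ⟨j, k, h⟩) else 0 := rfl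
  have hF2 (j k) (h : k < q j) : F j (k + 1) = b (Sum.inr ⟨j, k, h⟩) := by rw [hF1, dif_pos h]
  have hF3 (j k) (h : q j ≤ k) : F j (k + 1) = 0 := by rw [hF1, dif_neg (by omega)]
  have hE1 (i c) (h : c < p i + 1) : E i c = b (Sum.inl ⟨i, c, h⟩) := dif_pos h
  have hE2 (i c) (h : p i < c) : E i c = 0 := dif_neg (by omega)
  let X : Module.End ℂ (Fin N → ℂ) := b.constr ℂ (Sum.elim
    (fun s => ((p s.1 : ℂ) - (s.2 : ℕ)) • E s.1 (s.2 + 1)) (fun s => F s.1 s.2))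
  -- The value on `E i 0` is the one forced by `Z (F j 0) = -q_j F j 1`.
  let Z : Module.End ℂ (Fin N → ℂ) := b.constr ℂ (Sum.elim
    (fun s => Nat.casesOn (s.2 : ℕ) (∑ j, (G j s.1 * -(q j : ℂ)) • F j 1) (fun c => E s.1 c))
    (fun s => -((q s.1 : ℂ) - ((s.2 + 1 : ℕ) : ℂ)) • F s.1 (s.2 + 2)))
  let A : (Fin N → ℂ) →ₗ[ℂ] ℂ := b.constr ℂ (Sum.elim
    (fun s => if (s.2 : ℕ) = 0 then 1 else 0) (fun _ => 0))
  have hZE0 (i) : Z (E i 0) = ∑ j, (G j i * -(q j : ℂ)) • F j 1 := by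
    rw [hE1 i 0 (by omega)]
    simp [Z]
  have hAE (i c) : A (E i (c + 1)) = 0 := by
    by_cases h : c + 1 < p i + 1
    · rw [hE1 _ _ h]
      simp [A]
    · rw [hE2 _ _ (by omega), map_zero]
  refine ⟨⟨E, F, X, Z, A, ?_, ?_, hF3, ?_, ?_, ?_, ?_, ?_, hAE, ?_⟩⟩
  · intro f g hE hF
    refine b.ext fun s => ?_
    rcases s with ⟨i, c⟩ | ⟨j, k⟩
    · rw [← hE1 i c c.2]
      exact hE i c (by omega)
    · rw [← hF2 j k k.2]
      exact hF j k k.2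
  · intro i
    have h1 : ∀ l, ∑ j, ((p i : ℂ) + q j + 1)⁻¹ * G⁻¹ l j = if l = i then 1 else 0 := by
      intro l
      have := congrFun (congrFun (Matrix.nonsing_inv_mul G hdet) l) i
      rw [Matrix.mul_apply, Matrix.one_apply] at this
      rw [← this]
      refine Finset.sum_congr rfl fun j _ => ?_
      rw [hG, Matrix.of_apply, mul_comm]
    simp only [hF0, Finset.smul_sum, smul_smul]
    rw [Finset.sum_comm]
    simp only [← Finset.sum_smul, h1]
    simp
  · intro i c h
    conv_lhs => rw [hE1 i c (by omega)]
    simp [X]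
  · intro j k h
    conv_lhs => rw [hF2 j k h]
    simp [X]
  · intro i c h
    conv_lhs => rw [hE1 i (c + 1) (by omega)]
    simp [Z]
  · intro j k
    rcases k with _ | k
    · have h1 : ∀ l, ∑ i, G⁻¹ i j * (G l i * -(q l : ℂ)) = if l = j then -(q j : ℂ) else 0 := by
        intro l
        have := congrFun (congrFun (Matrix.mul_nonsing_inv G hdet) l) j
        rw [Matrix.mul_apply, Matrix.one_apply] at this
        have h2 : ∑ i, G⁻¹ i j * (G l i * -(q l : ℂ)) = (∑ i, G l i * G⁻¹ i j) * -(q l : ℂ) := by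
          rw [Finset.sum_mul]
          exact Finset.sum_congr rfl fun i _ => by ring
        rw [h2, this]
        split_ifs with h
        · rw [h, one_mul]
        · rw [zero_mul]
      rw [hF0, map_sum]
      simp only [map_smul, hZE0, Finset.smul_sum, smul_smul]
      rw [Finset.sum_comm]
      simp only [← Finset.sum_smul, h1]
      simp
    · by_cases h : k < q j
      · conv_lhs => rw [hF2 j k h]
        simp [Z]
      · rw [hF3 j k (by omega), hF3 j (k + 1) (by omega), map_zero, smul_zero]
  · intro i
    rw [hE1 i 0 (by omega)]
    simp [A]
  · intro j k
    by_cases h : k < q j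
    · rw [hF2 j k h]
      simp [A]
    · rw [hF3 j k (by omega), map_zero]

namespace HookModule

variable {V : Type*} [AddCommGroup V] [Module ℂ V] {r : ℕ} {p q : Fin r → ℕ}
  (H : HookModule V p q)

theorem Z_pow_F (j : Fin r) (l k : ℕ) :
    (H.Z ^ k) (H.F j l) = (∏ s ∈ Finset.range k, -((q j : ℂ) - (l + s : ℕ))) • H.F j (l + k) := by
  induction k with
  | zero => simp
  | succ k ih =>
    rw [pow_succ', Module.End.mul_apply, ih, map_smul, H.Z_F, smul_smul, Finset.prod_range_succ]
    rfl

theorem Z_pow_E (i : Fin r) (c k : ℕ) (h : c + k ≤ p i) :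
    (H.Z ^ k) (H.E i (c + k)) = H.E i c := by
  induction k with
  | zero => simp
  | succ k ih =>
    rw [pow_succ, Module.End.mul_apply, ← add_assoc, H.Z_E _ _ (by omega), ih (by omega)]

theorem Z_pow_F_eq_zero (j : Fin r) (l : ℕ) {k : ℕ} (hk : q j < k) : (H.Z ^ k) (H.F j l) = 0 := by
  rw [H.Z_pow_F, show l + k = (l + k - 1) + 1 by omega, H.F_eq_zero _ _ (by omega), smul_zero]

/-- After `c` steps the chain reaches `E i 0`, which is a combination of the `F j 0`; these die
after `q_j + 1` further steps. -/
theorem Z_pow_E_eq_zero (i : Fin r) (c : ℕ) {k n : ℕ} (hc : c ≤ p i) (hk : ∀ j, q j < k)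
    (hn : c + k ≤ n) : (H.Z ^ n) (H.E i c) = 0 := by
  rw [show n = (n - c) + c by omega, pow_add, Module.End.mul_apply]
  have h1 := H.Z_pow_E i 0 c (by omega)
  rw [zero_add] at h1
  rw [h1, H.E_zero, map_sum]
  refine Finset.sum_eq_zero fun j _ => ?_
  have := hk j
  rw [map_smul, H.Z_pow_F_eq_zero _ _ (by omega), smul_zero]

theorem isNilpotent_Z {M : ℕ} (hp : ∀ i, p i ≤ M) (hq : ∀ j, q j ≤ M) : IsNilpotent H.Z := by
  refine ⟨M + (M + 1), H.hom_ext _ _ (fun i c hc => ?_) (fun j k hk => ?_)⟩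
  · rw [H.Z_pow_E_eq_zero i c hc (k := M + 1) (fun j => Nat.lt_succ_of_le (hq j))]
    · rfl
    · have := hp i
      omega
  · have := hq j
    rw [H.Z_pow_F_eq_zero _ _ (by omega)]
    rfl

/-- Only the vectors `E i 0` see the rank one term. There `XZ - ZX - 1` multiplies the `F j 0`
component by `-(p_i + q_j + 1)`, which cancels the Cauchy entry and leaves a vector independent of
`i`. -/
theorem commutator : H.X * H.Z - H.Z * H.X - 1 = H.A.smulRight (-∑ j, H.F j 0) := by
  refine H.hom_ext _ _ (fun i c hc => ?_) (fun j k hk => ?_)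
  · simp only [LinearMap.sub_apply, Module.End.mul_apply, Module.End.one_apply,
      LinearMap.smulRight_apply]
    rcases c with _ | c
    · have hZX : H.Z (H.X (H.E i 0)) = (p i : ℂ) • H.E i 0 := by
        rw [H.X_E i 0 hc, map_smul]
        rcases Nat.eq_zero_or_pos (p i) with h | h
        · simp [h]
        · rw [H.Z_E i 0 h]
          simp
      have hXZ : ∀ j, H.X (H.Z (H.F j 0)) = -(q j : ℂ) • H.F j 0 := by
        intro j
        rw [H.Z_F, map_smul]
        rcases Nat.eq_zero_or_pos (q j) with h | h
        · simp [h]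
        · rw [H.X_F j 0 h]
          simp
      rw [hZX, H.A_E_zero, one_smul, H.E_zero, map_sum, map_sum, Finset.smul_sum,
        ← Finset.sum_sub_distrib, ← Finset.sum_sub_distrib, ← Finset.sum_neg_distrib]
      refine Finset.sum_congr rfl fun j _ => ?_
      have hne : (p i : ℂ) + q j + 1 ≠ 0 := by exact_mod_cast Nat.succ_ne_zero (p i + q j)
      rw [map_smul, map_smul, hXZ, smul_smul, smul_smul, ← sub_smul, ← sub_smul, ← neg_one_smul ℂ (H.F j 0)]
      congr 1
      field_simp
      ring
    · rw [H.Z_E i c (by omega), H.X_E i c (by omega), H.X_E i (c + 1) hc, map_smul, H.A_E, zero_smul]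
      rcases Nat.lt_or_ge (c + 1) (p i) with h | h
      · rw [H.Z_E i (c + 1) h]
        push_cast
        module
      · have : p i = c + 1 := by omega
        rw [this]
        push_cast
        module
  · simp only [LinearMap.sub_apply, Module.End.mul_apply, Module.End.one_apply,
      LinearMap.smulRight_apply]
    rw [H.Z_F, H.X_F j k hk, H.Z_F, map_smul, H.A_F, zero_smul]
    rcases Nat.lt_or_ge (k + 1) (q j) with h | h
    · rw [H.X_F j (k + 1) h]
      push_cast
      module
    · have : q j = k + 1 := by omega
      rw [this]
      push_cast
      module

theorem A_Z_pow_F (j : Fin r) {l k : ℕ} (h : 0 < l + k) : H.A ((H.Z ^ k) (H.F j l)) = 0 := by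
  rw [H.Z_pow_F, map_smul, show l + k = (l + k - 1) + 1 by omega, H.A_F, smul_zero]

theorem A_Z_pow_E (i : Fin r) (k : ℕ) :
    H.A ((H.Z ^ k) (H.E i (p i))) = if k = p i then 1 else 0 := by
  rcases Nat.lt_or_ge (p i) k with h | h
  · rw [if_neg (by omega), show k = (k - p i) + p i by omega, pow_add, Module.End.mul_apply]
    have h1 := H.Z_pow_E i 0 (p i) (by omega)
    rw [zero_add] at h1
    rw [h1, H.E_zero, map_sum, map_sum]
    refine Finset.sum_eq_zero fun j _ => ?_
    rw [map_smul, map_smul, H.A_Z_pow_F _ (by omega), smul_zero]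
  · have h1 := H.Z_pow_E i (p i - k) k (by omega)
    rw [show p i - k + k = p i by omega] at h1
    rw [h1]
    rcases Nat.lt_or_ge k (p i) with h2 | h2
    · rw [if_neg (by omega), show p i - k = (p i - k - 1) + 1 by omega, H.A_E]
    · rw [if_pos (by omega), show p i - k = 0 by omega, H.A_E_zero]

/-- A vector with `X v = Z ^ t (∑ F j 0)` in the part of degree `-t - 1`. -/
theorem exists_X_eq {t : ℕ} (ht : ∀ j, q j ≠ t) : ∃ v, (∀ k, H.A ((H.Z ^ k) v) = 0) ∧
    H.X v = (H.Z ^ t) (∑ j, H.F j 0) := by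
  -- If `t < q_j`, then `F j t = X (F j (t + 1))`; if `t > q_j`, then `F j t = 0`. Only `t = q_j` is
  -- obstructed.
  refine ⟨∑ j, (if t < q j then ∏ s ∈ Finset.range t, -((q j : ℂ) - (0 + s : ℕ)) else 0) •
    H.F j (t + 1), fun k => ?_, ?_⟩
  · rw [map_sum, map_sum]
    refine Finset.sum_eq_zero fun j _ => ?_
    rw [map_smul, map_smul, H.A_Z_pow_F _ (by omega), smul_zero]
  · rw [map_sum, map_sum]
    refine Finset.sum_congr rfl fun j _ => ?_
    rw [H.Z_pow_F, map_smul, zero_add]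
    rcases lt_or_gt_of_ne (ht j) with h | h
    · rw [if_neg (by omega), zero_smul, show t = (t - 1) + 1 by omega,
        H.F_eq_zero _ _ (by omega), smul_zero]
    · rw [if_pos h, H.X_F _ _ h]

end HookModule

/-- The chain ends `-E i (p i)` are killed by `X` and serve the exponents `N + pᵢ`. An exponent `m <
N` asks for a solution of `X v = Z^(N-1-m) (∑ F j 0)`, which exists unless `N - 1 - m` is some
`q_j`. -/
theorem exists_calogeroMoser {r N : ℕ} {p q : Fin r → ℕ} (hp : Function.Injective p)
    (hq : Function.Injective q) (hN : ∑ i, (p i + 1 + q i) = N) :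
    ∃ C : CalogeroMoser N, C.Z ^ N = 0 ∧ (∀ i, ∃ v, C.IsAdapted (N + p i) v) ∧
      ∀ m < N, (∀ j, q j ≠ N - 1 - m) → ∃ v, C.IsAdapted m v := by
  obtain ⟨H⟩ := nonempty_hookModule hp hq hN
  have hle : ∀ i, p i + 1 + q i ≤ N := fun i => by
    rw [← hN]
    exact Finset.single_le_sum (f := fun i => p i + 1 + q i) (fun _ _ => Nat.zero_le _)
      (Finset.mem_univ i)
  set a : Fin N → ℂ := fun i => H.A (Pi.single i 1) with ha
  have hA : ∀ v, a ⬝ᵥ v = H.A v := by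
    intro v
    conv_rhs => rw [pi_eq_sum_univ' v]
    rw [map_sum, dotProduct]
    refine Finset.sum_congr rfl fun i _ => ?_
    rw [map_smul, smul_eq_mul, mul_comm, ha]
  have hX : ∀ v, LinearMap.toMatrix' H.X *ᵥ v = H.X v := fun v => LinearMap.toMatrix'_mulVec _ _
  have hZ : ∀ v, LinearMap.toMatrix' H.Z *ᵥ v = H.Z v := fun v => LinearMap.toMatrix'_mulVec _ _
  let C : CalogeroMoser N :=
    { X := LinearMap.toMatrix' H.X
      Z := LinearMap.toMatrix' H.Z
      a := a
      b := -∑ j, H.F j 0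
      rank_one := by
        apply Matrix.mulVec_injective
        funext v
        have := congrArg (fun f : Module.End ℂ (Fin N → ℂ) => f v) H.commutator
        simp only [LinearMap.sub_apply, Module.End.mul_apply, Module.End.one_apply,
          LinearMap.smulRight_apply] at this
        rw [Matrix.vecMulVec_mulVec, hA, Matrix.sub_mulVec, Matrix.sub_mulVec,
          ← Matrix.mulVec_mulVec, ← Matrix.mulVec_mulVec, hX, hX, hZ, hZ, Matrix.one_mulVec, this]
        simp }
  have hpow : ∀ k v, C.Z ^ k *ᵥ v = (H.Z ^ k) v := by
    intro k
    induction k with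
    | zero => simp
    | succ k ih =>
      intro v
      rw [pow_succ', pow_succ', ← Matrix.mulVec_mulVec, ih, Module.End.mul_apply]
      exact hZ _
  refine ⟨C, ?_, fun i => ⟨-H.E i (p i), fun k => ?_, ?_⟩, fun m hm hj => ?_⟩
  · obtain ⟨M, hM⟩ := H.isNilpotent_Z (M := N) (fun i => by have := hle i; omega)
      (fun i => by have := hle i; omega)
    have hnil : IsNilpotent C.Z := by
      refine ⟨M, Matrix.mulVec_injective (funext fun v => ?_)⟩
      rw [hpow, hM]
      simp
    have h1 := Matrix.isNilpotent_charpoly_sub_pow_of_isNilpotent hnil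
    have h2 : C.Z.charpoly = Polynomial.X ^ N := by
      rw [← sub_eq_zero]
      simpa using h1.eq_zero
    have h3 := C.Z.aeval_self_charpoly
    rwa [h2, map_pow, Polynomial.aeval_X] at h3
  · rw [hpow, map_neg]
    change a ⬝ᵥ _ = _
    rw [hA, map_neg, H.A_Z_pow_E]
    by_cases h : k = p i
    · rw [if_pos h, if_pos (by omega)]
    · rw [if_neg h, if_neg (by omega), neg_zero]
  · rw [if_neg (by omega)]
    change LinearMap.toMatrix' H.X *ᵥ _ = _
    rw [hX, map_neg, H.X_E _ _ le_rfl]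
    simp
  · obtain ⟨v, hv1, hv2⟩ := H.exists_X_eq hj
    refine ⟨v, fun k => ?_, ?_⟩
    · rw [hpow, if_neg (by omega)]
      exact (hA _).trans (hv1 k)
    · rw [if_pos hm, hpow]
      change LinearMap.toMatrix' H.X *ᵥ _ = -((H.Z ^ _) (-∑ j, H.F j 0))
      rw [hX, hv2, map_neg, neg_neg]

/-! ### Frobenius coordinates of the partition and existence of the matrices. -/

theorem expo_injective {N : ℕ} {lam : Fin N → ℕ} (hanti : Antitone lam) :
    Function.Injective (expo lam) := by
  have : StrictAnti (expo lam) := by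
    intro i j hij
    have h1 := hanti hij.le
    have h2 : (i : ℕ) < j := hij
    have := i.2
    have := j.2
    simp only [expo]
    omega
  exact this.injective

/-- `P` consists of the exponents `≥ N` shifted by `N`, and `Q` of the gaps below `N` reflected by
`m ↦ N - 1 - m`. These are the Frobenius coordinates, and the two kinds of adapted vectors cover
exactly the `mᵢ`. -/
theorem exists_isPartitionPoint {N : ℕ} {lam : Fin N → ℕ} (hanti : Antitone lam)
    (hsum : ∑ i, lam i = N) : ∃ C : CalogeroMoser N, IsPartitionPoint lam C := by
  have hinj := expo_injective hanti
  set S : Finset ℕ := Finset.univ.image (expo lam) with hS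
  have hcard : S.card = N := by
    rw [hS, Finset.card_image_of_injective _ hinj, Finset.card_univ, Fintype.card_fin]
  set P : Finset ℕ := (S.filter (N ≤ ·)).image (· - N) with hP
  set Q : Finset ℕ := ((Finset.range N).filter (· ∉ S)).image (N - 1 - ·) with hQ
  have hPinj : Set.InjOn (· - N) (S.filter (N ≤ ·) : Set ℕ) := by
    intro a ha b hb hab
    simp only [Finset.coe_filter, Set.mem_ofPred_eq] at ha hb hab
    omega
  have hQinj : Set.InjOn (N - 1 - ·) ((Finset.range N).filter (· ∉ S) : Set ℕ) := by
    intro a ha b hb hab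
    simp only [Finset.coe_filter, Set.mem_ofPred_eq, Finset.mem_range] at ha hb hab
    omega
  have hSlt : (Finset.range N).filter (· ∈ S) = S.filter (¬ N ≤ ·) := by
    ext a
    simp only [Finset.mem_filter, Finset.mem_range, not_le]
    tauto
  have hPQ : Q.card = P.card := by
    rw [hP, hQ, Finset.card_image_of_injOn hPinj, Finset.card_image_of_injOn hQinj]
    have h1 := Finset.card_filter_add_card_filter_not (s := S) (N ≤ ·)
    have h2 := Finset.card_filter_add_card_filter_not (s := Finset.range N) (· ∈ S)
    rw [Finset.card_range, hSlt] at h2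
    omega
  -- With weight `a + 1 - N`, the sum over `S` exceeds the sum over `{0, …, N - 1}` by `∑ λᵢ = N`.
  -- Elements common to both cancel, leaving `P` and the gaps.
  have htot : ∑ a ∈ P, (a + 1) + ∑ a ∈ Q, a = N := by
    rw [hP, hQ, Finset.sum_image hPinj, Finset.sum_image hQinj]
    have e1 : ∑ a ∈ S, ((a : ℤ) + 1 - N) = ∑ a ∈ S.filter (N ≤ ·), ((a : ℤ) + 1 - N)
        + ∑ a ∈ S.filter (¬ N ≤ ·), ((a : ℤ) + 1 - N) :=
      (Finset.sum_filter_add_sum_filter_not _ _ _).symm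
    have e2 : ∑ a ∈ Finset.range N, ((a : ℤ) + 1 - N)
        = ∑ a ∈ S.filter (¬ N ≤ ·), ((a : ℤ) + 1 - N)
        + ∑ a ∈ (Finset.range N).filter (· ∉ S), ((a : ℤ) + 1 - N) := by
      rw [← hSlt]
      exact (Finset.sum_filter_add_sum_filter_not _ _ _).symm
    have e3 : ∑ a ∈ S, ((a : ℤ) + 1 - N) = N + ∑ a ∈ Finset.range N, ((a : ℤ) + 1 - N) := by
      rw [hS, Finset.sum_image fun _ _ _ _ h => hinj h]
      have h1 : ∀ i : Fin N, ((expo lam i : ℕ) : ℤ) + 1 - N = lam i + ((N - 1 - (i : ℕ) : ℕ) + 1 - N) := by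
        intro i
        have := i.2
        simp only [expo]
        omega
      simp only [h1, Finset.sum_add_distrib]
      rw [Fin.sum_univ_eq_sum_range (fun i => ((N - 1 - i : ℕ) : ℤ) + 1 - N) N]
      rw [Finset.sum_range_reflect (fun i => ((i : ℕ) : ℤ) + 1 - N) N, ← Nat.cast_sum, hsum]
    have e4 : ((∑ a ∈ S.filter (N ≤ ·), (a - N + 1) : ℕ) : ℤ)
        = ∑ a ∈ S.filter (N ≤ ·), ((a : ℤ) + 1 - N) := by
      rw [Nat.cast_sum]
      refine Finset.sum_congr rfl fun a ha => ?_
      have := (Finset.mem_filter.mp ha).2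
      omega
    have e5 : ((∑ a ∈ (Finset.range N).filter (· ∉ S), (N - 1 - a) : ℕ) : ℤ)
        = -∑ a ∈ (Finset.range N).filter (· ∉ S), ((a : ℤ) + 1 - N) := by
      rw [Nat.cast_sum, ← Finset.sum_neg_distrib]
      refine Finset.sum_congr rfl fun a ha => ?_
      have := Finset.mem_range.mp (Finset.mem_filter.mp ha).1
      omega
    rw [← Nat.cast_inj (R := ℤ), Nat.cast_add, e4, e5]
    linarith
  set eP := (P.equivFin).symm with heP
  set eQ := (Q.equivFinOfCardEq hPQ).symm with heQ
  have hN : ∑ i, ((eP i : ℕ) + 1 + (eQ i : ℕ)) = N := by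
    rw [Finset.sum_add_distrib, eP.sum_comp (fun a : P => (a : ℕ) + 1),
      eQ.sum_comp (fun a : Q => (a : ℕ)), Finset.sum_coe_sort P (fun a => a + 1),
      Finset.sum_coe_sort Q (fun a => a), htot]
  obtain ⟨C, hZ, h1, h2⟩ := exists_calogeroMoser (Subtype.val_injective.comp eP.injective)
    (Subtype.val_injective.comp eQ.injective) hN
  refine ⟨C, isPartitionPoint_of_isAdapted hZ fun i => ?_⟩
  have hmem : expo lam i ∈ S := Finset.mem_image_of_mem _ (Finset.mem_univ i)
  rcases Nat.lt_or_ge (expo lam i) N with h | h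
  · refine h2 _ h fun j hj => ?_
    have hQj := (eQ j).2
    simp only [Function.comp_apply] at hj
    rw [hj, hQ, Finset.mem_image] at hQj
    obtain ⟨a, ha, hae⟩ := hQj
    simp only [Finset.mem_filter, Finset.mem_range] at ha
    have : a = expo lam i := by omega
    exact ha.2 (this ▸ hmem)
  · have hPm : expo lam i - N ∈ P :=
      Finset.mem_image.mpr ⟨_, Finset.mem_filter.mpr ⟨hmem, h⟩, rfl⟩
    obtain ⟨v, hv⟩ := h1 (eP.symm ⟨_, hPm⟩)
    refine ⟨v, ?_⟩
    simpa [Nat.add_sub_cancel' h] using hv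

end KPHermite

namespace KPHermite

/-! ### Determinants of falling factorials and their generating function. -/

section Vandermonde

/-- The matrix of the falling factorials of `m₁, …, m_N`. -/
noncomputable def fallingMatrix {N : ℕ} (m : Fin N → ℕ) : Matrix (Fin N) (Fin N) ℂ :=
  Matrix.of fun i j => ((m j).descFactorial i : ℂ)

/-- The matrix of falling factorials of order up to `N` of `m₁, …, m_N`, with the last column
`v`. -/
noncomputable def borderedMatrix {N : ℕ} (m : Fin N → ℕ) (v : Fin (N + 1) → ℂ) :
    Matrix (Fin (N + 1)) (Fin (N + 1)) ℂ :=
  Matrix.of fun i j => (Fin.snoc (α := fun _ => ℂ) (fun j => ((m j).descFactorial i : ℂ)) (v i) j : ℂ)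

/-- Row `i` evaluates a monic polynomial of degree `i` at the `m_j`. -/
theorem det_fallingMatrix {N : ℕ} (m : Fin N → ℕ) :
    (fallingMatrix m).det = (Matrix.vandermonde fun j => (m j : ℂ)).det := by
  rw [Matrix.det_eval_matrixOfPolynomials_eq_det_vandermonde _ (fun i => descPochhammer ℂ i)
    (fun i => descPochhammer_natDegree ℂ i) (fun i => monic_descPochhammer ℂ i),
    ← Matrix.det_transpose]
  congr 1
  ext i j
  simp [fallingMatrix, descPochhammer_eval_eq_descFactorial]

theorem det_fallingMatrix_ne_zero {N : ℕ} {m : Fin N → ℕ} (hm : Function.Injective m) :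
    (fallingMatrix m).det ≠ 0 := by
  rw [det_fallingMatrix, Matrix.det_vandermonde_ne_zero_iff]
  exact Nat.cast_injective.comp hm

theorem det_vandermonde_snoc {R : Type*} [CommRing R] {N : ℕ} (v : Fin N → R) (x : R) :
    (Matrix.vandermonde (Fin.snoc (α := fun _ => R) v x : Fin (N + 1) → R)).det
      = (Matrix.vandermonde v).det * ∏ j, (x - v j) := by
  have hswap : ∀ {k : ℕ} (w : Fin k → R), (Matrix.vandermonde w).det
      = ∏ j, ∏ i ∈ Finset.Iio j, (w j - w i) := by
    intro k w
    rw [Matrix.det_vandermonde]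
    refine Finset.prod_comm' fun i j => ?_
    simp
  rw [hswap, hswap, Fin.prod_univ_castSucc]
  congr 1
  · refine Finset.prod_congr rfl fun j _ => ?_
    rw [Fin.Iio_castSucc, Finset.prod_map]
    simp
  · rw [Fin.Iio_last_eq_map, Finset.prod_map]
    simp

theorem det_borderedMatrix_descFactorial {N : ℕ} (m : Fin N → ℕ) (n : ℕ) :
    (borderedMatrix m fun i => (n.descFactorial i : ℂ)).det
      = (fallingMatrix m).det * ∏ j, ((n : ℂ) - m j) := by
  have h : borderedMatrix m (fun i => (n.descFactorial i : ℂ))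
      = fallingMatrix (Fin.snoc (α := fun _ => ℕ) m n : Fin (N + 1) → ℕ) := by
    ext i j
    refine Fin.lastCases ?_ (fun j => ?_) j <;> simp [borderedMatrix, fallingMatrix]
  have h2 : (fun j => ((Fin.snoc (α := fun _ => ℕ) m n : Fin (N + 1) → ℕ) j : ℂ))
      = (Fin.snoc (α := fun _ => ℂ) (fun j => (m j : ℂ)) (n : ℂ) : Fin (N + 1) → ℂ) := by
    funext j
    refine Fin.lastCases ?_ (fun j => ?_) j <;> simp
  rw [h, det_fallingMatrix, det_fallingMatrix, h2, det_vandermonde_snoc]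

/-- Expansion along the last column: one set of cofactors serves both the falling factorials of `n`
and the powers of `z`. -/
theorem exists_det_borderedMatrix {N : ℕ} (m : Fin N → ℕ) : ∃ κ : ℕ → ℂ,
    κ N = (fallingMatrix m).det ∧
      ∀ v : ℕ → ℂ, (borderedMatrix m fun i => v i).det = ∑ i ∈ Finset.range (N + 1), κ i * v i := by
  obtain ⟨κ, hκ⟩ : ∃ κ : Fin (N + 1) → ℂ, κ = fun i : Fin (N + 1) => (-1) ^ ((i : ℕ) + N) * (Matrix.of
    fun a b : Fin N => ((m b).descFactorial (i.succAbove a) : ℂ)).det := ⟨_, rfl⟩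
  refine ⟨fun i => if h : i < N + 1 then κ ⟨i, h⟩ else 0, ?_, fun v => ?_⟩
  · refine (dif_pos (Nat.lt_succ_self N)).trans ?_
    rw [hκ]
    change (-1) ^ (N + N) * (Matrix.of
      fun a b : Fin N => ((m b).descFactorial ((Fin.last N).succAbove a) : ℂ)).det = _
    rw [Even.neg_one_pow ⟨N, rfl⟩, one_mul]
    congr 1
    ext a b
    simp [fallingMatrix]
  · rw [← Fin.sum_univ_eq_sum_range (fun i => (if h : i < N + 1 then κ ⟨i, h⟩ else 0) * v i),
      Matrix.det_succ_column _ (Fin.last N)]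
    refine Finset.sum_congr rfl fun i _ => ?_
    rw [dif_pos i.2, hκ]
    have h1 : (borderedMatrix m fun i => v i).submatrix i.succAbove (Fin.last N).succAbove
        = Matrix.of fun a b : Fin N => ((m b).descFactorial (i.succAbove a) : ℂ) := by
      ext a b
      simp [borderedMatrix]
    rw [h1]
    simp [borderedMatrix]
    ring

theorem hasSum_det_borderedMatrix {N : ℕ} (m : Fin N → ℕ) (z : ℂ) :
    HasSum (fun n : ℕ => (fallingMatrix m).det * (∏ j, ((n : ℂ) - m j)) * (n.factorial : ℂ)⁻¹ * z ^ n)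
      ((borderedMatrix m fun i => z ^ (i : ℕ)).det * Complex.exp z) := by
  obtain ⟨κ, -, hκ⟩ := exists_det_borderedMatrix m
  have hexp : HasSum (fun n : ℕ => z ^ n / (n.factorial : ℂ)) (Complex.exp z) := by
    rw [Complex.exp_eq_exp_ℂ]
    exact NormedSpace.exp_series_hasSum_exp' z |>.congr_fun fun n => by
      rw [smul_eq_mul, div_eq_inv_mul]
  have hshift : ∀ i : ℕ, HasSum
      (fun n : ℕ => (n.descFactorial i : ℂ) * ((n.factorial : ℂ)⁻¹ * z ^ n))
      (z ^ i * Complex.exp z) := by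
    intro i
    have h1 : ∀ n : ℕ, ((n + i).descFactorial i : ℂ) * (((n + i).factorial : ℂ)⁻¹ * z ^ (n + i))
        = z ^ i * (z ^ n / (n.factorial : ℂ)) := by
      intro n
      have h2 := Nat.factorial_mul_descFactorial (Nat.le_add_left i n)
      rw [Nat.add_sub_cancel] at h2
      have h3 : ((n + i).factorial : ℂ) = n.factorial * ((n + i).descFactorial i : ℂ) := by
        exact_mod_cast h2.symm
      have h4 : ((n + i).factorial : ℂ) ≠ 0 := by exact_mod_cast (n + i).factorial_ne_zero
      have h5 : (n.factorial : ℂ) ≠ 0 := by exact_mod_cast n.factorial_ne_zero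
      rw [pow_add]
      field_simp
      rw [h3]
      ring
    rw [← hasSum_nat_add_iff' i, Finset.sum_eq_zero, sub_zero]
    · simpa only [h1] using hexp.mul_left (z ^ i)
    · intro n hn
      rw [Nat.descFactorial_of_lt (Finset.mem_range.mp hn)]
      simp
  have hsum := hasSum_sum fun i (_ : i ∈ Finset.range (N + 1)) => (hshift i).mul_left (κ i)
  rw [hκ fun i => z ^ i]
  convert! hsum using 1
  · funext n
    rw [← det_borderedMatrix_descFactorial, hκ fun i => (n.descFactorial i : ℂ), mul_assoc,
      Finset.sum_mul]
    exact Finset.sum_congr rfl fun i _ => by ring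
  · rw [Finset.sum_mul]
    exact Finset.sum_congr rfl fun i _ => by ring

end Vandermonde

/-! ### The Wronskians at `y = 0`. -/

section Restriction

theorem kappa_zero {N : ℕ} (lam : Fin N → ℕ) (i : Fin N) :
    kappa lam 0 i = fun x => x ^ expo lam i := by
  funext x
  have h : psi0 x 0 = fun s => psi0 s 0 x := by
    funext s
    simp [psi0, mul_comm]
  rw [kappa, h, iteratedDeriv_psi0_left]
  simp [psi0]

theorem iteratedDeriv_kappa_zero {N : ℕ} (lam : Fin N → ℕ) (i : Fin N) (j : ℕ) {x : ℂ}
    (hx : x ≠ 0) : iteratedDeriv j (kappa lam 0 i) x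
      = x ^ expo lam i * (x⁻¹ ^ j * ((expo lam i).descFactorial j : ℂ)) := by
  have h : kappa lam 0 i = fun x => ((Polynomial.X : Polynomial ℂ) ^ expo lam i).eval x := by
    rw [kappa_zero]
    simp
  rw [h, iteratedDeriv_eval, Polynomial.iterate_derivative_X_pow_eq_natCast_mul]
  simp only [Polynomial.eval_mul, Polynomial.eval_natCast, Polynomial.eval_pow, Polynomial.eval_X]
  rcases Nat.lt_or_ge (expo lam i) j with hj | hj
  · simp [Nat.descFactorial_of_lt hj]
  · rw [pow_sub₀ _ hx hj, inv_pow]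
    ring

theorem prod_pow_expo {N : ℕ} {lam : Fin N → ℕ} (hsum : ∑ i, lam i = N) (x : ℂ) :
    ∏ i, x ^ expo lam i = x ^ N * ∏ i : Fin N, x ^ (i : ℕ) := by
  rw [Finset.prod_pow_eq_pow_sum, Finset.prod_pow_eq_pow_sum, ← pow_add]
  congr 1
  have h1 : ∀ i : Fin N, expo lam i = lam i + (N - 1 - (i : ℕ)) := by
    intro i
    have := i.2
    simp only [expo]
    omega
  simp only [h1, Finset.sum_add_distrib, hsum]
  rw [Fin.sum_univ_eq_sum_range (fun i => N - 1 - i) N, Finset.sum_range_reflect (fun i => i) N,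
    Fin.sum_univ_eq_sum_range (fun i => i) N]

/-- Factoring `x ^ m_j` from the columns and `x ^ (-i)` from the rows leaves falling factorials; the
total exponent is `∑ λᵢ = N`. -/
theorem wronskian_kappa_zero {N : ℕ} {lam : Fin N → ℕ} (hsum : ∑ i, lam i = N) {x : ℂ}
    (hx : x ≠ 0) : wronskian (kappa lam 0) x = (fallingMatrix (expo lam)).det * x ^ N := by
  have h1 : wronskian (kappa lam 0) x = (∏ i, x ^ expo lam i) * ((∏ i : Fin N, x⁻¹ ^ (i : ℕ))
      * (fallingMatrix (expo lam)).det) := by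
    rw [← Matrix.det_mul_column, ← Matrix.det_mul_row, wronskian]
    congr 1
    ext i j
    simp [iteratedDeriv_kappa_zero lam _ _ hx, fallingMatrix]
  have h2 : (∏ i : Fin N, x ^ (i : ℕ)) * ∏ i : Fin N, x⁻¹ ^ (i : ℕ) = 1 := by
    rw [← Finset.prod_mul_distrib]
    exact Finset.prod_eq_one fun i _ => by rw [← mul_pow, mul_inv_cancel₀ hx, one_pow]
  rw [h1, prod_pow_expo hsum]
  linear_combination (x ^ N * (fallingMatrix (expo lam)).det) * h2

theorem wronskian_snoc_kappa_zero {N : ℕ} {lam : Fin N → ℕ} (hsum : ∑ i, lam i = N) {x : ℂ}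
    (hx : x ≠ 0) (z : ℂ) :
    wronskian (Fin.snoc (α := fun _ => ℂ → ℂ) (kappa lam 0) (fun s => psi0 s 0 z)) x
      = (borderedMatrix (expo lam) fun i => (x * z) ^ (i : ℕ)).det * psi0 x 0 z := by
  have h1 : wronskian (Fin.snoc (α := fun _ => ℂ → ℂ) (kappa lam 0) (fun s => psi0 s 0 z)) x
      = (∏ j : Fin (N + 1), (Fin.snoc (α := fun _ => ℂ) (fun i => x ^ expo lam i) (psi0 x 0 z) j : ℂ))
      * ((∏ i : Fin (N + 1), x⁻¹ ^ (i : ℕ))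
      * (borderedMatrix (expo lam) fun i => (x * z) ^ (i : ℕ)).det) := by
    rw [← Matrix.det_mul_column, ← Matrix.det_mul_row, wronskian]
    congr 1
    ext i j
    refine Fin.lastCases ?_ (fun j => ?_) j
    · simp only [Matrix.of_apply, Fin.snoc_last, iteratedDeriv_psi0_left, borderedMatrix]
      rw [mul_pow, inv_pow]
      field_simp
    · simp [iteratedDeriv_kappa_zero lam _ _ hx, borderedMatrix]
  have h2 : (∏ i : Fin N, x ^ (i : ℕ)) * ∏ i : Fin N, x⁻¹ ^ (i : ℕ) = 1 := by
    rw [← Finset.prod_mul_distrib]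
    exact Finset.prod_eq_one fun i _ => by rw [← mul_pow, mul_inv_cancel₀ hx, one_pow]
  have h3 : x ^ N * x⁻¹ ^ N = 1 := by rw [← mul_pow, mul_inv_cancel₀ hx, one_pow]
  rw [h1, Fin.prod_univ_castSucc, Fin.prod_univ_castSucc]
  simp only [Fin.snoc_castSucc, Fin.snoc_last, Fin.val_castSucc, Fin.val_last]
  rw [prod_pow_expo hsum]
  linear_combination ((borderedMatrix (expo lam) fun i => (x * z) ^ (i : ℕ)).det * psi0 x 0 z)
    * (h3 * ((∏ i : Fin N, x ^ (i : ℕ)) * ∏ i : Fin N, x⁻¹ ^ (i : ℕ)) + h2)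

end Restriction

/-! ### Characteristic polynomials of `X` and `Z` from the wave function. -/

section Uniqueness

-- Jacobi's formula, read off from `det(A + s) = det A (1 + s tr A⁻¹ + O(s²))`.
open Polynomial in
theorem derivative_charpoly_eval {n : Type*} [Fintype n] [DecidableEq n] (M : Matrix n n ℂ) {x : ℂ}
    (hx : (x • 1 - M).det ≠ 0) :
    M.charpoly.derivative.eval x = M.charpoly.eval x * ((x • 1 - M)⁻¹).trace := by
  have hev : ∀ t, M.charpoly.eval t = (t • 1 - M).det := fun t => by
    rw [Matrix.eval_charpoly, Matrix.scalar_apply, Matrix.smul_one_eq_diagonal]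
  set A := x • 1 - M with hA
  have hu : IsUnit A.det := isUnit_iff_ne_zero.mpr hx
  have h1 : HasDerivAt (fun s => M.charpoly.eval (x + s)) (M.charpoly.derivative.eval x) 0 := by
    have := (M.charpoly.hasDerivAt (x + 0)).comp_const_add x 0
    simpa using this
  have h2 : (fun s => M.charpoly.eval (x + s)) = fun s => A.det * (1 + A⁻¹.trace * s
      + (Matrix.det (1 + (X : ℂ[X]) • A⁻¹.map C)).divX.divX.eval s * s ^ 2) := by
    funext s
    rw [← Matrix.det_one_add_smul, ← Matrix.det_mul, hev]
    congr 1
    rw [mul_add, mul_one, Matrix.mul_smul, Matrix.mul_nonsing_inv _ hu, hA, add_smul]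
    abel
  have h3 : HasDerivAt (fun s : ℂ => A.det * (1 + A⁻¹.trace * s
      + (Matrix.det (1 + (X : ℂ[X]) • A⁻¹.map C)).divX.divX.eval s * s ^ 2))
      (A.det * A⁻¹.trace) 0 := by
    have e1 : HasDerivAt (fun s : ℂ => 1 + A⁻¹.trace * s) A⁻¹.trace 0 := by
      simpa using ((hasDerivAt_id (0 : ℂ)).const_mul A⁻¹.trace).const_add 1
    have e2 := ((Matrix.det (1 + (X : ℂ[X]) • A⁻¹.map C)).divX.divX.hasDerivAt 0).mul
      ((hasDerivAt_id (0 : ℂ)).pow 2)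
    refine ((e1.add e2).const_mul A.det).congr_deriv ?_
    simp
  rw [h2] at h1
  rw [h1.unique h3, hev]

/-- Take the trace of `A⁻¹ b aᵀ = A⁻¹ Z A - Z - A⁻¹`; conjugation makes the first two terms cancel.
-/
theorem CalogeroMoser.dot_inv_mulVec {N : ℕ} (C : CalogeroMoser N) {x : ℂ}
    (hx : (x • 1 - C.X).det ≠ 0) :
    C.a ⬝ᵥ ((x • 1 - C.X)⁻¹ *ᵥ C.b) = -((x • 1 - C.X)⁻¹).trace := by
  set A := x • 1 - C.X with hA
  have hu : IsUnit A.det := isUnit_iff_ne_zero.mpr hx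
  have h1 : Matrix.vecMulVec C.b C.a = C.Z * A - A * C.Z - 1 := by
    rw [← C.rank_one, hA]
    simp [mul_sub, sub_mul]
  rw [dotProduct_comm, ← Matrix.trace_vecMulVec, ← Matrix.mul_vecMulVec, h1, mul_sub, mul_sub, mul_one,
    Matrix.trace_sub, Matrix.trace_sub, ← mul_assoc A⁻¹ A, Matrix.nonsing_inv_mul _ hu, one_mul,
    Matrix.trace_mul_comm A⁻¹, mul_assoc, Matrix.mul_nonsing_inv _ hu, mul_one, sub_self, zero_sub]

open Polynomial in
theorem eq_X_pow_of_X_mul_derivative {χ : ℂ[X]} {N : ℕ} (hχ : χ.Monic) (hN : χ.natDegree = N)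
    {p : ℂ} (h : X * derivative χ = C p * χ) : χ = X ^ N := by
  have hk : ∀ k : ℕ, (k : ℂ) * χ.coeff k = p * χ.coeff k := by
    intro k
    have := congrArg (coeff · k) h
    simp only [coeff_C_mul] at this
    rw [← this]
    rcases k with _ | k
    · simp
    · rw [coeff_X_mul, coeff_derivative]
      push_cast
      ring
  have hp : p = N := by
    have := hk N
    rw [← hN, hχ.coeff_natDegree] at this
    rw [← hN]
    simpa using this.symm
  ext k
  rw [coeff_X_pow]
  split_ifs with hkN
  · rw [hkN, ← hN, hχ.coeff_natDegree]
  · have h1 := hk k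
    rw [hp] at h1
    have h2 : ((k : ℂ) - N) * χ.coeff k = 0 := by linear_combination h1
    refine (mul_eq_zero.mp h2).resolve_left fun h3 => hkN ?_
    exact_mod_cast sub_eq_zero.mp h3

/-- The coefficient of `1/z` at `z = ∞` is `aᵀ (x - X)⁻¹ b = p / x`. By `dot_inv_mulVec` it also
equals `-χ'/χ`, so `x χ' = -p χ` and `χ` is a monomial. -/
theorem CalogeroMoser.charpoly_X_eq {N : ℕ} (C : CalogeroMoser N) {ρ : ℂ → ℂ} {p : ℂ}
    (hρ0 : ρ 0 = 1) (hρ : HasDerivAt ρ p 0)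
    (h : ∀ x z : ℂ, (x • 1 - C.X).det ≠ 0 → (z • 1 - C.Z).det ≠ 0 → x ≠ 0 → z ≠ 0 →
      1 + C.a ⬝ᵥ ((x • 1 - C.X)⁻¹ *ᵥ ((z • 1 - C.Z)⁻¹ *ᵥ C.b)) = ρ ((x * z)⁻¹)) :
    C.X.charpoly = Polynomial.X ^ N := by
  have hev : ∀ t, C.X.charpoly.eval t = (t • 1 - C.X).det := fun t => by
    rw [Matrix.eval_charpoly, Matrix.scalar_apply, Matrix.smul_one_eq_diagonal]
  have key : ∀ x : ℂ, (x • 1 - C.X).det ≠ 0 → x ≠ 0 → ((x • 1 - C.X)⁻¹).trace = -p / x := by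
    intro x hx hx0
    set A := x • 1 - C.X with hA
    -- With `t = 1/z`, this extends `z aᵀ (x - X)⁻¹ (z - Z)⁻¹ b` continuously to `t = 0`.
    set f : ℂ → ℂ := fun t => (1 - t • C.Z).det⁻¹ *
      (C.a ⬝ᵥ (A⁻¹ *ᵥ ((1 - t • C.Z).adjugate *ᵥ C.b))) with hf
    have hcont : Continuous fun t : ℂ => 1 - t • C.Z := by fun_prop
    have hfc : ContinuousAt f 0 := by
      refine ContinuousAt.mul (ContinuousAt.inv₀ hcont.matrix_det.continuousAt (by simp)) ?_
      refine Continuous.continuousAt ?_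
      exact continuous_const.dotProduct
        (continuous_const.matrix_mulVec (hcont.matrix_adjugate.matrix_mulVec continuous_const))
    have hf0 : f 0 = C.a ⬝ᵥ (A⁻¹ *ᵥ C.b) := by simp [hf]
    have hslope : HasDerivAt (fun t => ρ (t / x)) (p / x) 0 := by
      have e1 : HasDerivAt (fun t : ℂ => t / x) (1 / x) 0 := (hasDerivAt_id (0 : ℂ)).div_const x
      have e2 := HasDerivAt.comp_of_eq (0 : ℂ) hρ e1 (by simp)
      exact e2.congr_deriv (by ring)
    have hev1 : ∀ᶠ t in 𝓝[≠] (0 : ℂ), slope (fun t => ρ (t / x)) 0 t = f t := by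
      have hd : ∀ᶠ t in 𝓝 (0 : ℂ), (1 - t • C.Z).det ≠ 0 :=
        hcont.matrix_det.continuousAt.eventually_ne (by simp)
      filter_upwards [hd.filter_mono nhdsWithin_le_nhds, self_mem_nhdsWithin] with t ht ht0
      have ht0 : t ≠ 0 := ht0
      have hB : t⁻¹ • 1 - C.Z = t⁻¹ • (1 - t • C.Z) := by
        rw [smul_sub, smul_smul, inv_mul_cancel₀ ht0, one_smul]
      have hinv : (t⁻¹ • 1 - C.Z)⁻¹
          = (t * (1 - t • C.Z).det⁻¹) • (1 - t • C.Z).adjugate := by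
        apply Matrix.inv_eq_right_inv
        rw [hB, smul_mul_smul_comm, Matrix.mul_adjugate, smul_smul,
          show t⁻¹ * (t * (1 - t • C.Z).det⁻¹) * (1 - t • C.Z).det = 1 by field_simp, one_smul]
      have hdet : (t⁻¹ • 1 - C.Z).det ≠ 0 := by
        rw [hB, Matrix.det_smul]
        exact mul_ne_zero (pow_ne_zero _ (inv_ne_zero ht0)) ht
      have h1 := h x t⁻¹ hx hdet hx0 (inv_ne_zero ht0)
      rw [hinv, mul_inv, inv_inv, mul_comm x⁻¹] at h1
      simp only [Matrix.smul_mulVec, Matrix.mulVec_smul, dotProduct_smul, smul_eq_mul] at h1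
      rw [slope_def_field, div_eq_mul_inv t x, ← h1, zero_div, hρ0, hf, sub_zero]
      field_simp
      ring
    have h2 := hslope.tendsto_slope.congr' hev1
    have h3 := tendsto_nhds_unique h2 (hfc.tendsto.mono_left nhdsWithin_le_nhds)
    rw [hf0, C.dot_inv_mulVec hx] at h3
    rw [neg_div, h3, neg_neg]
  refine eq_X_pow_of_X_mul_derivative (p := -p) (Matrix.charpoly_monic _)
    (by rw [Matrix.charpoly_natDegree_eq_dim, Fintype.card_fin]) ?_
  -- Multiplying the identity by `X χ` makes it hold trivially at `0` and at the eigenvalues, where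
  -- the trace formula is unavailable.
  have hne : (Polynomial.X : Polynomial ℂ) * C.X.charpoly ≠ 0 :=
    mul_ne_zero Polynomial.X_ne_zero (Matrix.charpoly_monic _).ne_zero
  rw [← sub_eq_zero]
  refine (mul_eq_zero.mp (?_ : (Polynomial.X : Polynomial ℂ) * C.X.charpoly * _ = 0)).resolve_left hne
  refine Polynomial.funext fun x => ?_
  simp only [Polynomial.eval_mul, Polynomial.eval_sub, Polynomial.eval_X, Polynomial.eval_C,
    Polynomial.eval_zero]
  by_cases hx0 : x = 0
  · simp [hx0]
  by_cases hx : (x • 1 - C.X).det = 0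
  · rw [hev, hx]
    ring
  · rw [derivative_charpoly_eval _ hx, key x hx hx0]
    field_simp
    ring

/-- The bispectral dual of Calogero-Moser matrices. -/
def CalogeroMoser.dual {N : ℕ} (C : CalogeroMoser N) : CalogeroMoser N where
  X := C.Zᵀ
  Z := C.Xᵀ
  a := C.b
  b := C.a
  rank_one := by
    have h := congrArg Matrix.transpose C.rank_one
    rw [Matrix.transpose_sub, Matrix.transpose_sub, Matrix.transpose_mul, Matrix.transpose_mul,
      Matrix.transpose_one, Matrix.transpose_vecMulVec] at h
    exact h

theorem CalogeroMoser.dual_dot {N : ℕ} (C : CalogeroMoser N) (x z : ℂ) :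
    C.dual.a ⬝ᵥ ((z • 1 - C.dual.X)⁻¹ *ᵥ ((x • 1 - C.dual.Z)⁻¹ *ᵥ C.dual.b))
      = C.a ⬝ᵥ ((x • 1 - C.X)⁻¹ *ᵥ ((z • 1 - C.Z)⁻¹ *ᵥ C.b)) := by
  have h1 : ∀ (t : ℂ) (M : Matrix (Fin N) (Fin N) ℂ), (t • 1 - Mᵀ)⁻¹ = ((t • 1 - M)⁻¹)ᵀ := by
    intro t M
    rw [Matrix.transpose_nonsing_inv]
    simp
  change C.b ⬝ᵥ ((z • 1 - C.Zᵀ)⁻¹ *ᵥ ((x • 1 - C.Xᵀ)⁻¹ *ᵥ C.a)) = _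
  rw [h1, h1, Matrix.mulVec_transpose, Matrix.mulVec_transpose, Matrix.dotProduct_mulVec,
    Matrix.dotProduct_mulVec, dotProduct_comm]

end Uniqueness

/-- At `y = 0` the factor of `ψ` before the exponential is a function `ρ` of `(xz)⁻¹` alone, so
`charpoly_X_eq` applies to `C` and to its dual. Hence `τ(1, 0) = 1` and `q(z) = z^N`, which cancels
the pole of `ψ_λ` for every choice of `C`. -/
theorem psiHatHat_of_isPartitionPoint {N : ℕ} {lam : Fin N → ℕ} (hanti : Antitone lam)
    (hsum : ∑ i, lam i = N) {C : CalogeroMoser N} (hC : IsPartitionPoint lam C) (z : ℂ) :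
    (fallingMatrix (expo lam)).det * C.psiHatHat 1 0 z
      = (borderedMatrix (expo lam) fun i => z ^ (i : ℕ)).det * Complex.exp z := by
  have hΔ := det_fallingMatrix_ne_zero (expo_injective hanti)
  set Δ := (fallingMatrix (expo lam)).det with hΔdef
  obtain ⟨κ, hκN, hκ⟩ := exists_det_borderedMatrix (expo lam)
  have htX : ∀ x, C.tildeX x 0 = x • 1 - C.X := fun x => by simp [CalogeroMoser.tildeX]
  have hpsi0 : ∀ x z, psi0 x 0 z ≠ 0 := fun x z => Complex.exp_ne_zero _
  have hLam : ∀ x z : ℂ, x ≠ 0 → z ≠ 0 → psiLam lam x 0 z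
      = (borderedMatrix (expo lam) fun i => (x * z) ^ (i : ℕ)).det / (Δ * (x * z) ^ N)
        * psi0 x 0 z := by
    intro x z hx hz
    rw [psiLam, wronskian_snoc_kappa_zero hsum hx, wronskian_kappa_zero hsum hx, ← hΔdef, mul_pow]
    field_simp
  set ρ : ℂ → ℂ := fun t => (∑ i ∈ Finset.range (N + 1), κ i * t ^ (N - i)) / Δ with hρ
  have hρ0 : ρ 0 = 1 := by
    simp only [hρ]
    rw [Finset.sum_range_succ, Finset.sum_eq_zero, zero_add, Nat.sub_self, pow_zero, mul_one, hκN,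
      div_self hΔ]
    intro i hi
    have := Finset.mem_range.mp hi
    rw [zero_pow (by omega), mul_zero]
  have hρd : HasDerivAt ρ (deriv ρ 0) 0 := by
    refine DifferentiableAt.hasDerivAt ?_
    simp only [hρ]
    fun_prop
  have hrel : ∀ x z : ℂ, (x • 1 - C.X).det ≠ 0 → (z • 1 - C.Z).det ≠ 0 → x ≠ 0 → z ≠ 0 →
      1 + C.a ⬝ᵥ ((x • 1 - C.X)⁻¹ *ᵥ ((z • 1 - C.Z)⁻¹ *ᵥ C.b)) = ρ ((x * z)⁻¹) := by
    intro x z hx hz hx0 hz0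
    have h1 := hC x 0 z (by rwa [CalogeroMoser.tau, htX]) hz hz0 (by
      rw [wronskian_kappa_zero hsum hx0]
      exact mul_ne_zero hΔ (pow_ne_zero _ hx0))
    rw [hLam x z hx0 hz0, CalogeroMoser.psi, htX] at h1
    have h2 := mul_right_cancel₀ (hpsi0 x z) h1
    rw [CalogeroMoser.tildeZ] at h2
    rw [h2, hκ fun i => (x * z) ^ i]
    have hw : x * z ≠ 0 := mul_ne_zero hx0 hz0
    simp only [hρ]
    rw [div_eq_div_iff (mul_ne_zero hΔ (pow_ne_zero _ hw)) hΔ, Finset.sum_mul, Finset.sum_mul]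
    refine Finset.sum_congr rfl fun i hi => ?_
    have hi := Finset.mem_range.mp hi
    have h3 : (x * z) ^ N = (x * z) ^ (N - i) * (x * z) ^ i := by
      rw [← pow_add]
      congr 1
      omega
    have h4 : (x * z)⁻¹ ^ (N - i) * (x * z) ^ (N - i) = 1 := by
      rw [← mul_pow, inv_mul_cancel₀ hw, one_pow]
    rw [h3]
    linear_combination (-(κ i * Δ * (x * z) ^ i)) * h4
  have hX := C.charpoly_X_eq hρ0 hρd hrel
  have hdetT : ∀ (t : ℂ) (M : Matrix (Fin N) (Fin N) ℂ), (t • 1 - Mᵀ).det = (t • 1 - M).det := by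
    intro t M
    rw [← Matrix.det_transpose (t • 1 - M)]
    simp
  have hZ : C.Z.charpoly = Polynomial.X ^ N := by
    have := C.dual.charpoly_X_eq hρ0 hρd (fun z x hz hx hz0 hx0 => by
      rw [C.dual_dot, mul_comm z x]
      exact hrel x z (by rwa [← hdetT]) (by rwa [← hdetT]) hx0 hz0)
    rwa [show C.dual.X = C.Zᵀ from rfl, Matrix.charpoly_transpose] at this
  have hdet : ∀ (M : Matrix (Fin N) (Fin N) ℂ), M.charpoly = Polynomial.X ^ N →
      ∀ t : ℂ, (t • 1 - M).det = t ^ N := by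
    intro M hM t
    have h1 := Matrix.eval_charpoly M t
    rw [hM, Matrix.scalar_apply, ← Matrix.smul_one_eq_diagonal] at h1
    rw [← h1]
    simp
  have htau : C.tau 1 0 = 1 := by rw [CalogeroMoser.tau, htX, hdet _ hX, one_pow]
  have hq : ∀ z, C.q z = z ^ N := fun z => by rw [CalogeroMoser.q, CalogeroMoser.tildeZ, hdet _ hZ]
  have hne : ∀ z : ℂ, z ≠ 0 → Δ * C.psiHatHat 1 0 z
      = (borderedMatrix (expo lam) fun i => z ^ (i : ℕ)).det * Complex.exp z := by
    intro z hz
    have hqz : C.q z ≠ 0 := by rw [hq]; exact pow_ne_zero _ hz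
    have htau' : C.tau 1 0 ≠ 0 := by rw [htau]; exact one_ne_zero
    rw [C.psiHatHat_eq htau' hqz, hC 1 0 z htau' hqz hz (by
      rw [wronskian_kappa_zero hsum one_ne_zero]
      exact mul_ne_zero hΔ (pow_ne_zero _ one_ne_zero)), hLam 1 z one_ne_zero hz, htau, hq]
    have hp : psi0 1 0 z = Complex.exp z := by simp [psi0]
    simp only [one_mul, hp]
    field_simp
  have hcL : Continuous fun z => Δ * C.psiHatHat 1 0 z := by
    have h1 : Continuous fun z => C.tildeZ z := by
      unfold CalogeroMoser.tildeZ
      fun_prop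
    unfold CalogeroMoser.psiHatHat CalogeroMoser.q psi0
    refine continuous_const.mul ((((continuous_const.mul h1.matrix_det)).add ?_).mul (by fun_prop))
    exact continuous_const.dotProduct
        (continuous_const.matrix_mulVec (h1.matrix_adjugate.matrix_mulVec continuous_const))
  have hcR : Continuous fun z : ℂ =>
      (borderedMatrix (expo lam) fun i => z ^ (i : ℕ)).det * Complex.exp z := by
    have h1 : ∀ z : ℂ, (borderedMatrix (expo lam) fun i => z ^ (i : ℕ)).det
        = ∑ i ∈ Finset.range (N + 1), κ i * z ^ i := fun z => hκ fun i => z ^ i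
    simp only [h1]
    fun_prop
  -- The comparison with `psiLam` needs `z ≠ 0`; both sides are continuous, which gives `z = 0`.
  have hdense : Dense ({0}ᶜ : Set ℂ) := dense_compl_singleton 0
  exact congrFun (hcL.ext_on hdense hcR fun z hz => hne z hz) z

end KPHermite

theorem mainTheorem7 (N : ℕ) (lam : Fin N → ℕ) (hanti : Antitone lam)
    (hsum : ∑ i, lam i = N) :
    (∃ C : KPHermite.CalogeroMoser N, KPHermite.IsPartitionPoint lam C) ∧
    ∃ ν : ℕ → ℂ,
      (∀ n, KPHermite.HasHermiteProduct {x | KPHermite.hermiteWronskian lam x = 0}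
        (KPHermite.hHat lam n) (KPHermite.hHat lam n) (ν n)) ∧
      ∀ C : KPHermite.CalogeroMoser N, KPHermite.IsPartitionPoint lam C →
        ∀ z : ℂ, HasSum (fun n => ν n * z ^ n)
          ((Real.sqrt (2 * Real.pi) : ℂ) * C.psiHatHat 1 0 z) := by
  have hinj := KPHermite.expo_injective hanti
  refine ⟨KPHermite.exists_isPartitionPoint hanti hsum, _,
    fun n => KPHermite.hasHermiteProduct_hHat hinj n, fun C hC z => ?_⟩
  have hΔ := KPHermite.det_fallingMatrix_ne_zero hinj
  have h1 := KPHermite.psiHatHat_of_isPartitionPoint hanti hsum hC z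
  have h2 := (KPHermite.hasSum_det_borderedMatrix (KPHermite.expo lam) z).mul_left
    ((Real.sqrt (2 * Real.pi) : ℂ) * (KPHermite.fallingMatrix (KPHermite.expo lam)).det⁻¹)
  rw [← h1] at h2
  convert! h2 using 1
  · funext n
    field_simp
  · field_simp
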